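/- Let $\mathcal D$ be a class of finite groups and, for $G,H\in\mathcal D$, let $\mathcal S_{G,H}$ be a set of twisted diagonal subgroups of $G\times H$, i.e. of subgroups $\{(\alpha(v),v)\mid v\in V\}$ with $U\le G$, $V\le H$ and $\alpha\colon V\to U$ an isomorphism. Assume that for all $G,H,K\in\mathcal D$: $\mathcal S_{G,H}$ is closed under $G\times H$-conjugation and under taking subgroups; $L*M:=\{(g,k)\mid \exists h\in H:\ (g,h)\in L,\ (h,k)\in M\}\in\mathcal S_{G,K}$ for all $L\in\mathcal S_{G,H}$, $M\in\mathcal S_{H,K}$; and $\Delta(G)=\{(g,g)\mid g\in G\}\in\mathcal S_{G,G}$. Fix $G\in\mathcal D$ and assume moreover that $L^\circ:=\{(h,g)\mid (g,h)\in L\}\in\mathcal S_{G,G}$ for every $L\in\mathcal S_{G,G}$. Let $B(G,G)$ be the double Burnside ring (the Grothendieck group of finite $(G,G)$-bisets, viewed as $G\times G$-sets via $(g,h)x=gxh^{-1}$, with multiplication induced by $X\times_G Y$), let $B^{\mathcal S}(G,G)$ be its subring spanned by the classes $[(G\times G)/L]$, $L\in\mathcal S_{G,G}$, and let $RB^{\mathcal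 S}(G,G)=R\otimes_{\mathbb Z}B^{\mathcal S}(G,G)$. Let $\mathcal S_G$ be the category whose objects are the subgroups of $G$ and whose morphisms $V\to U$ are the homomorphisms $\phi$ with $\{(\phi(v),v)\mid v\in V\}\in\mathcal S_{G,G}$, and let $\tilde{\mathcal S}_G$ be a set of representatives of the isomorphism classes of its objects. For $U\le G$ put $\mathrm{Out}_{\mathcal S_G}(U)=\mathrm{Aut}_{\mathcal S_G}(U)/\mathrm{Inn}(U)$ and $\overline{\mathrm{Hom}}_{\mathcal S_G}(U,G)=\mathrm{Inn}(G)\backslash\mathrm{Hom}_{\mathcal S_G}(U,G)$, a right $\mathrm{Out}_{\mathcal S_G}(U)$-set by composition. Let $R$ be a field in which $|G|$ and $|\mathrm{Out}_{\mathcal S_G}(U)|$, for all $U\in\tilde{\mathcal S}_G$, are invertible. Then the $R$-algebra $RB^{\mathcal S}(G,G)$ is semisimple. Its isomorphism classes of simple modules are in bijective correspondence with the pairs $(U,[V])$, where $U\in\tilde{\mathcal S}_G$ and $[V]$ is the isomorphism class of a simple (right) $R\mathrm{Out}_{\mathcal S_G}(U)$-module $V$ that occurs as a direct summand in the permutation module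 $R\overline{\mathrm{Hom}}_{\mathcal S_G}(U,G)$. Explicitly, a bijection sends $(U,[V])$ to the class of $\mathrm{Hom}_{R\mathrm{Out}_{\mathcal S_G}(U)}\bigl(V,R\overline{\mathrm{Hom}}_{\mathcal S_G}(U,G)\bigr)$, on which the class of a biset $X$ with point stabilizers in $\mathcal S_{G,G}$ acts by composition with $$[\psi]\mapsto\sum_{[\phi]\in\overline{\mathrm{Hom}}_{\mathcal S_G}(U,G)}\frac{|X^{L(\phi,\psi)}|}{|C_G(\phi(U))|}\,[\phi],\qquad L(\phi,\psi)=\{(\phi(u),\psi(u))\mid u\in U\}.$$ -/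

import Mathlib

universe u v w

open scoped TensorProduct

namespace BurnsideRing

/-! ### Subgroups of direct products -/

section Subgroups

variable {G H K : Type*} [Group G] [Group H] [Group K]

/-- The diagonal subgroup `Δ(G) = {(g, g)}` of `G × G`. -/
def diagonal (G : Type*) [Group G] : Subgroup (G × G) :=
  ((MonoidHom.id G).prod (MonoidHom.id G)).range

/-- For a homomorphism `φ` from a subgroup `V ≤ H` to `G`, the subgroup `{(φ(v), v) | v ∈ V}`
of `G × H`. -/
def graph {V : Subgroup H} (φ : V →* G) : Subgroup (G × H) := (φ.prod V.subtype).range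

/-- `L` is a twisted diagonal subgroup `Δ(U, α, V) = {(α(v), v) | v ∈ V}` of `G × H`, where
`U ≤ G`, `V ≤ H` and `α : V → U` is an isomorphism. -/
def IsTwistedDiagonal (L : Subgroup (G × H)) : Prop :=
  ∃ (U : Subgroup G) (V : Subgroup H) (α : V ≃* U),
    L = graph (U.subtype.comp α.toMonoidHom)

/-- The opposite subgroup `L° = {(h, g) | (g, h) ∈ L}`. -/
def opposite (L : Subgroup (G × H)) : Subgroup (H × G) :=
  L.comap (MulEquiv.prodComm : H × G ≃* G × H).toMonoidHom

/-- The composition `L * M` of `L ≤ G × H` and `M ≤ H × K` viewed as relations. -/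
def starProd (L : Subgroup (G × H)) (M : Subgroup (H × K)) : Subgroup (G × K) where
  carrier := {x | ∃ h : H, (x.1, h) ∈ L ∧ (h, x.2) ∈ M}
  one_mem' := ⟨1, L.one_mem, M.one_mem⟩
  mul_mem' := by
    rintro a b ⟨h, h1, h2⟩ ⟨k, k1, k2⟩
    exact ⟨h * k, L.mul_mem h1 k1, M.mul_mem h2 k2⟩
  inv_mem' := by
    rintro a ⟨h, h1, h2⟩
    exact ⟨h⁻¹, L.inv_mem h1, M.inv_mem h2⟩

/-- The conjugate `ˣL = x L x⁻¹`. -/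
def conjugate (x : G) (L : Subgroup G) : Subgroup G := L.map (MulAut.conj x).toMonoidHom

end Subgroups

/-- Condition (I) for a class of groups `Grp x` (`x : D`) and sets `S x y` of subgroups of
`Grp x × Grp y`: closure under conjugation, under taking subgroups, under composition `*`,
and membership of the diagonal subgroups. -/
structure ConditionI {D : Type v} (Grp : D → Type u) [∀ x, Group (Grp x)]
    (S : ∀ x y, Set (Subgroup (Grp x × Grp y))) : Prop where
  conj_mem : ∀ x y, ∀ L ∈ S x y, ∀ a : Grp x × Grp y, conjugate a L ∈ S x y
  subgroup_mem : ∀ x y, ∀ L ∈ S x y, ∀ L' : Subgroup (Grp x × Grp y), L' ≤ L → L' ∈ S x y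
  star_mem : ∀ x y z, ∀ L ∈ S x y, ∀ M ∈ S y z, starProd L M ∈ S x z
  diagonal_mem : ∀ x, diagonal (Grp x) ∈ S x x

/-- Condition (I) for a single group `G` and a single set `S` of subgroups of `G × G`. -/
structure IsStable {G : Type u} [Group G] (S : Set (Subgroup (G × G))) : Prop where
  conj_mem : ∀ L ∈ S, ∀ a : G × G, conjugate a L ∈ S
  subgroup_mem : ∀ L ∈ S, ∀ L' : Subgroup (G × G), L' ≤ L → L' ∈ S
  star_mem : ∀ L ∈ S, ∀ M ∈ S, starProd L M ∈ S
  diagonal_mem : diagonal G ∈ S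

theorem ConditionI.isStable {D : Type v} {Grp : D → Type u} [∀ x, Group (Grp x)]
    {S : ∀ x y, Set (Subgroup (Grp x × Grp y))} (h : ConditionI Grp S) (x : D) :
    IsStable (S x x) :=
  ⟨h.conj_mem x x, h.subgroup_mem x x, h.star_mem x x x, h.diagonal_mem x⟩

/-! ### Bisets -/

/-- A finite `(G, G)`-biset, encoded as a finite `G × G`-set through `(g, h) x = g x h⁻¹`. -/
structure FinBiset (G : Type u) [Group G] where
  carrier : Type u
  [action : MulAction (G × G) carrier]
  [finite : Finite carrier]

attribute [instance] FinBiset.action FinBiset.finite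

namespace FinBiset

section Basic

variable {G : Type u} [Group G]

/-- Isomorphism of bisets: an equivariant bijection. -/
def Iso (X Y : FinBiset G) : Prop :=
  ∃ e : X.carrier ≃ Y.carrier, ∀ (g : G × G) (x : X.carrier), e (g • x) = g • e x

instance isoSetoid (G : Type u) [Group G] : Setoid (FinBiset G) where
  r := Iso
  iseqv :=
    { refl := fun _ => ⟨Equiv.refl _, fun _ _ => rfl⟩
      symm := by
        rintro X Y ⟨e, he⟩
        exact ⟨e.symm, fun g y => by rw [Equiv.symm_apply_eq, he, Equiv.apply_symm_apply]⟩
      trans := by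
        rintro X Y Z ⟨e, he⟩ ⟨f, hf⟩
        exact ⟨e.trans f, fun g x => by simp [he, hf]⟩ }

/-- The coproduct (disjoint union) of bisets. -/
def coprod (X Y : FinBiset G) : FinBiset G where
  carrier := X.carrier ⊕ Y.carrier
  action :=
    { smul := fun g => Sum.map (g • ·) (g • ·)
      one_smul := by rintro (x | x) <;> simp [HSMul.hSMul] <;> exact one_smul _ x
      mul_smul := by rintro g h (x | x) <;> simp [HSMul.hSMul] <;> exact mul_smul g h x }

/-- The set `X × Y` modulo the action `h (x, y) = (x h⁻¹, h y)` of the middle group. -/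
def tensorSetoid (X Y : FinBiset G) : Setoid (X.carrier × Y.carrier) where
  r p q := ∃ h : G, q.1 = ((1, h) : G × G) • p.1 ∧ q.2 = ((h, 1) : G × G) • p.2
  iseqv :=
    { refl := fun p => ⟨1, (one_smul _ _).symm, (one_smul _ _).symm⟩
      symm := by
        rintro p q ⟨h, h1, h2⟩
        refine ⟨h⁻¹, ?_, ?_⟩
        · rw [h1, smul_smul]; simp [← Prod.one_eq_mk]
        · rw [h2, smul_smul]; simp [← Prod.one_eq_mk]
      trans := by
        rintro p q r ⟨h, h1, h2⟩ ⟨k, k1, k2⟩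
        refine ⟨k * h, ?_, ?_⟩
        · rw [k1, h1, smul_smul]; simp
        · rw [k2, h2, smul_smul]; simp }

/-- The tensor product `X ×_G Y`, with `g (x ×_G y) k = g x ×_G y k`. -/
def tensor (X Y : FinBiset G) : FinBiset G where
  carrier := Quotient (tensorSetoid X Y)
  action :=
    { smul := fun g => Quotient.map
        (fun p => (((g.1, 1) : G × G) • p.1, ((1, g.2) : G × G) • p.2)) (by
          rintro p q ⟨h, h1, h2⟩
          refine ⟨h, ?_, ?_⟩
          · simp only [h1, smul_smul]; simp
          · simp only [h2, smul_smul]; simp)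
      one_smul := by
        rintro ⟨p⟩
        exact Quotient.sound ⟨1, by simp [← Prod.one_eq_mk], by simp [← Prod.one_eq_mk]⟩
      mul_smul := by
        rintro g h ⟨p⟩
        refine Quotient.sound ⟨1, ?_, ?_⟩
        · simp [← Prod.one_eq_mk, smul_smul]
        · simp [← Prod.one_eq_mk, smul_smul] }

/-- The class `x ×_G y`. -/
def tmk {X Y : FinBiset G} (x : X.carrier) (y : Y.carrier) : (tensor X Y).carrier :=
  Quotient.mk (tensorSetoid X Y) (x, y)

theorem smul_tmk {X Y : FinBiset G} (g : G × G) (x : X.carrier) (y : Y.carrier) :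
    g • tmk x y = tmk (((g.1, 1) : G × G) • x) (((1, g.2) : G × G) • y) := rfl

theorem tmk_eq {X Y : FinBiset G} {x x' : X.carrier} {y y' : Y.carrier} :
    tmk x y = tmk x' y' ↔
      ∃ h : G, x' = ((1, h) : G × G) • x ∧ y' = ((h, 1) : G × G) • y :=
  ⟨fun h => Quotient.exact h, fun h => Quotient.sound h⟩

/-- Eliminator for `X ×_G Y`. -/
def tlift {X Y : FinBiset G} {α : Sort*} (f : X.carrier → Y.carrier → α)
    (hf : ∀ (h : G) x y, f (((1, h) : G × G) • x) (((h, 1) : G × G) • y) = f x y) :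
    (tensor X Y).carrier → α :=
  Quotient.lift (fun p => f p.1 p.2) (by
    rintro ⟨x, y⟩ ⟨x', y'⟩ ⟨h, h1, h2⟩
    simp only at h1 h2 ⊢
    rw [h1, h2, hf])

theorem tensor_ind {X Y : FinBiset G} {p : (tensor X Y).carrier → Prop}
    (h : ∀ x y, p (tmk x y)) (z) : p z := by
  rcases z with ⟨⟨x, y⟩⟩
  exact h x y

/-- The biset `(G × G)/L`. -/
def coset [Finite G] (L : Subgroup (G × G)) : FinBiset G where
  carrier := (G × G) ⧸ L

/-- All point stabilizers of `X` belong to `S`. -/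
def StabilizersIn (S : Set (Subgroup (G × G))) (X : FinBiset G) : Prop :=
  ∀ x : X.carrier, MulAction.stabilizer (G × G) x ∈ S

end Basic

section Regular

variable (G : Type u) [Group G] [Finite G]

/-- The group `G` as a `(G, G)`-biset through left and right multiplication. -/
def regular : FinBiset G where
  carrier := G
  action :=
    { smul := fun g x => g.1 * x * g.2⁻¹
      one_smul := fun x => by simp [HSMul.hSMul]
      mul_smul := fun g h x => by simp [HSMul.hSMul, mul_assoc] }

end Regular

section Laws

variable {G : Type u} [Group G]

theorem smul_regular [Finite G] (g : G × G) (x : G) :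
    (g • (show (regular G).carrier from x)) = (show (regular G).carrier from g.1 * x * g.2⁻¹) :=
  rfl

theorem coprod_congr {X X' Y Y' : FinBiset G} (h : Iso X X') (k : Iso Y Y') :
    Iso (coprod X Y) (coprod X' Y') := by
  obtain ⟨e, he⟩ := h
  obtain ⟨f, hf⟩ := k
  refine ⟨Equiv.sumCongr e f, ?_⟩
  rintro g (x | x)
  · exact congrArg Sum.inl (he g x)
  · exact congrArg Sum.inr (hf g x)

theorem tensor_congr {X X' Y Y' : FinBiset G} (h : Iso X X') (k : Iso Y Y') :
    Iso (tensor X Y) (tensor X' Y') := by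
  obtain ⟨e, he⟩ := h
  obtain ⟨f, hf⟩ := k
  have he' : ∀ (g : G × G) x, e.symm (g • x) = g • e.symm x := fun g y => by
    rw [Equiv.symm_apply_eq, he, Equiv.apply_symm_apply]
  have hf' : ∀ (g : G × G) x, f.symm (g • x) = g • f.symm x := fun g y => by
    rw [Equiv.symm_apply_eq, hf, Equiv.apply_symm_apply]
  refine ⟨⟨tlift (fun x y => tmk (e x) (f y)) ?_, tlift (fun x y => tmk (e.symm x) (f.symm y)) ?_,
    ?_, ?_⟩, ?_⟩
  · intro h x y
    rw [he, hf]
    exact (tmk_eq.2 ⟨h, rfl, rfl⟩).symm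
  · intro h x y
    rw [he', hf']
    exact (tmk_eq.2 ⟨h, rfl, rfl⟩).symm
  · refine tensor_ind fun x y => ?_
    change tmk (e.symm (e x)) (f.symm (f y)) = _
    simp
  · refine tensor_ind fun x y => ?_
    change tmk (e (e.symm x)) (f (f.symm y)) = _
    simp
  · intro g
    refine tensor_ind fun x y => ?_
    change tmk (e _) (f _) = tmk _ _
    rw [he, hf]

theorem tensor_assoc (X Y Z : FinBiset G) :
    Iso (tensor (tensor X Y) Z) (tensor X (tensor Y Z)) := by
  have key : ∀ (g h : G) (W : FinBiset G) (x : W.carrier),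
      ((g, 1) : G × G) • ((1, h) : G × G) • x = ((1, h) : G × G) • ((g, 1) : G × G) • x := by
    intro g h W x
    simp [smul_smul]
  refine ⟨⟨tlift (fun p z => tlift (fun x y => tmk x (tmk y z)) ?_ p) ?_,
    tlift (fun x p => tlift (fun y z => tmk (tmk x y) z) ?_ p) ?_, ?_, ?_⟩, ?_⟩
  · intro h x y
    refine (tmk_eq.2 ⟨h, rfl, ?_⟩).symm
    rw [smul_tmk]
    exact tmk_eq.2 ⟨1, by simp [← Prod.one_eq_mk], by simp [← Prod.one_eq_mk]⟩
  · intro h p z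
    revert p
    refine tensor_ind fun x y => ?_
    change tmk (((1, 1) : G × G) • x) (tmk (((1, h) : G × G) • y) _) = tmk x (tmk y z)
    refine (tmk_eq.2 ⟨1, rfl, ?_⟩).symm
    rw [← Prod.one_eq_mk, one_smul]
    exact (tmk_eq.2 ⟨h, rfl, rfl⟩).symm
  · intro h y z
    refine (tmk_eq.2 ⟨h, ?_, rfl⟩).symm
    rw [smul_tmk]
    exact tmk_eq.2 ⟨1, by simp [← Prod.one_eq_mk], by simp [← Prod.one_eq_mk]⟩
  · intro h x p
    revert p
    refine tensor_ind fun y z => ?_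
    change tmk (tmk _ (((h, 1) : G × G) • y)) (((1, 1) : G × G) • z) = tmk (tmk x y) z
    refine (tmk_eq.2 ⟨1, ?_, rfl⟩).symm
    rw [← Prod.one_eq_mk, one_smul]
    exact (tmk_eq.2 ⟨h, rfl, rfl⟩).symm
  · refine tensor_ind fun p z => ?_
    revert p
    exact tensor_ind fun x y => rfl
  · refine tensor_ind fun x p => ?_
    revert p
    exact tensor_ind fun x y => rfl
  · intro g
    refine tensor_ind fun p z => ?_
    revert p
    refine tensor_ind fun x y => ?_
    change tmk (((g.1, 1) : G × G) • x) (tmk (((1, 1) : G × G) • y) (((1, g.2) : G × G) • z)) =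
      tmk (((g.1, 1) : G × G) • x) (tmk (((1, 1) : G × G) • y) (((1, g.2) : G × G) • z))
    rfl

theorem regular_tensor [Finite G] (X : FinBiset G) : Iso (tensor (regular G) X) X := by
  refine ⟨⟨tlift (fun (a : G) x => ((a, 1) : G × G) • x) ?_, fun x => tmk (X := regular G) (1 : G) x,
    ?_, ?_⟩, ?_⟩
  · intro h (a : G) x
    change (((1 * a * h⁻¹ : G), 1) : G × G) • _ = _
    simp [smul_smul]
  · refine tensor_ind fun (a : G) x => ?_
    refine tmk_eq.2 ⟨a⁻¹, ?_, ?_⟩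
    · change a = 1 * 1 * (a⁻¹)⁻¹
      simp
    · change x = _ • ((a, 1) : G × G) • x
      simp [smul_smul, ← Prod.one_eq_mk]
  · intro x
    change ((1, 1) : G × G) • x = x
    simp [← Prod.one_eq_mk]
  · intro g
    refine tensor_ind fun (a : G) x => ?_
    change (((g.1 * a * 1⁻¹ : G), 1) : G × G) • ((1, g.2) : G × G) • x = g • ((a, 1) : G × G) • x
    simp only [smul_smul]
    congr 1
    ext <;> simp

theorem tensor_regular [Finite G] (X : FinBiset G) : Iso (tensor X (regular G)) X := by
  refine ⟨⟨tlift (fun x (a : G) => ((1, a⁻¹) : G × G) • x) ?_,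
    fun x => tmk (Y := regular G) x (1 : G), ?_, ?_⟩, ?_⟩
  · intro h x (a : G)
    change ((1, (h * a * 1⁻¹ : G)⁻¹) : G × G) • _ = _
    simp [smul_smul]
  · refine tensor_ind fun x (a : G) => ?_
    refine tmk_eq.2 ⟨a, ?_, ?_⟩
    · change x = _ • ((1, a⁻¹) : G × G) • x
      simp [smul_smul, ← Prod.one_eq_mk]
    · change a = a * 1 * 1⁻¹
      simp
  · intro x
    change ((1, 1⁻¹) : G × G) • x = x
    simp [← Prod.one_eq_mk]
  · intro g
    refine tensor_ind fun x (a : G) => ?_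
    change ((1, (1 * a * g.2⁻¹ : G)⁻¹) : G × G) • ((g.1, 1) : G × G) • x =
      g • ((1, a⁻¹) : G × G) • x
    simp only [smul_smul]
    congr 1
    ext <;> simp

theorem tensor_coprod (X Y Z : FinBiset G) :
    Iso (tensor X (coprod Y Z)) (coprod (tensor X Y) (tensor X Z)) := by
  refine ⟨⟨tlift (Y := coprod Y Z) (fun x => Sum.elim (fun y => Sum.inl (tmk x y))
      (fun z => Sum.inr (tmk x z))) ?_,
    Sum.elim (tlift (fun x y => tmk (Y := coprod Y Z) x (Sum.inl y)) ?_)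
      (tlift (fun x z => tmk (Y := coprod Y Z) x (Sum.inr z)) ?_), ?_, ?_⟩, ?_⟩
  · rintro h x (y | z)
    · exact congrArg Sum.inl (tmk_eq.2 ⟨h, rfl, rfl⟩).symm
    · exact congrArg Sum.inr (tmk_eq.2 ⟨h, rfl, rfl⟩).symm
  · intro h x y
    exact (tmk_eq (Y := coprod Y Z) (x := x) (y := Sum.inl y) |>.2 ⟨h, rfl, rfl⟩).symm
  · intro h x y
    exact (tmk_eq (Y := coprod Y Z) (x := x) (y := Sum.inr y) |>.2 ⟨h, rfl, rfl⟩).symm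
  · refine tensor_ind ?_
    rintro x (y | z) <;> rfl
  · rintro (p | p)
    · revert p
      exact tensor_ind fun _ _ => rfl
    · revert p
      exact tensor_ind fun _ _ => rfl
  · intro g
    refine tensor_ind ?_
    rintro x (y | z) <;> rfl

theorem coprod_tensor (X Y Z : FinBiset G) :
    Iso (tensor (coprod X Y) Z) (coprod (tensor X Z) (tensor Y Z)) := by
  refine ⟨⟨tlift (X := coprod X Y) (fun p z => Sum.elim (fun x => Sum.inl (tmk x z))
      (fun y => Sum.inr (tmk y z)) p) ?_,
    Sum.elim (tlift (fun x z => tmk (X := coprod X Y) (Sum.inl x) z) ?_)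
      (tlift (fun y z => tmk (X := coprod X Y) (Sum.inr y) z) ?_), ?_, ?_⟩, ?_⟩
  · rintro h (x | y) z
    · exact congrArg Sum.inl (tmk_eq.2 ⟨h, rfl, rfl⟩).symm
    · exact congrArg Sum.inr (tmk_eq.2 ⟨h, rfl, rfl⟩).symm
  · intro h x y
    exact (tmk_eq (X := coprod X Y) (x := Sum.inl x) (y := y) |>.2 ⟨h, rfl, rfl⟩).symm
  · intro h x y
    exact (tmk_eq (X := coprod X Y) (x := Sum.inr x) (y := y) |>.2 ⟨h, rfl, rfl⟩).symm
  · refine tensor_ind ?_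
    rintro (x | y) z <;> rfl
  · rintro (p | p)
    · revert p
      exact tensor_ind fun _ _ => rfl
    · revert p
      exact tensor_ind fun _ _ => rfl
  · intro g
    refine tensor_ind ?_
    rintro (x | y) z <;> rfl

/-- The stabilizer of `x ×_G y` is `stab(x) * stab(y)`. -/
theorem stabilizer_tmk {X Y : FinBiset G} (x : X.carrier) (y : Y.carrier) :
    MulAction.stabilizer (G × G) (tmk x y) =
      starProd (MulAction.stabilizer (G × G) x) (MulAction.stabilizer (G × G) y) := by
  ext ⟨g, k⟩
  rw [MulAction.mem_stabilizer_iff, smul_tmk, eq_comm, tmk_eq]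
  have h1 : ∀ h : G, ((g, 1) : G × G) • x = ((1, h) : G × G) • x ↔
      ((g, h⁻¹) : G × G) • x = x := by
    intro h
    rw [← inv_smul_eq_iff, smul_smul]
    simp
  have h2 : ∀ h : G, ((1, k) : G × G) • y = ((h, 1) : G × G) • y ↔
      ((h⁻¹, k) : G × G) • y = y := by
    intro h
    rw [← inv_smul_eq_iff, smul_smul]
    simp
  simp only [h1, h2]
  constructor
  · rintro ⟨h, k1, k2⟩
    exact ⟨h⁻¹, k1, k2⟩
  · rintro ⟨h, k1, k2⟩
    exact ⟨h⁻¹, by rw [inv_inv]; exact k1, by rw [inv_inv]; exact k2⟩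

theorem StabilizersIn.tensor {S : Set (Subgroup (G × G))} (hS : IsStable S) {X Y : FinBiset G}
    (hX : StabilizersIn S X) (hY : StabilizersIn S Y) : StabilizersIn S (tensor X Y) :=
  tensor_ind fun x y => by
    rw [stabilizer_tmk]
    exact hS.star_mem _ (hX x) _ (hY y)

theorem StabilizersIn.regular [Finite G] {S : Set (Subgroup (G × G))} (hS : IsStable S) :
    StabilizersIn S (regular G) := by
  intro (x : G)
  refine hS.subgroup_mem _ (hS.conj_mem _ hS.diagonal_mem (x, 1)) _ ?_
  rintro ⟨g, h⟩ hg
  have hg' : g * x * h⁻¹ = x := hg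
  refine ⟨(h, h), ⟨h, rfl⟩, ?_⟩
  have : g = x * h * x⁻¹ := by
    rw [mul_inv_eq_iff_eq_mul] at hg'
    rw [← hg']
    simp
  simp [this]

theorem StabilizersIn.coset [Finite G] {S : Set (Subgroup (G × G))} (hS : IsStable S)
    {L : Subgroup (G × G)} (hL : L ∈ S) : StabilizersIn S (coset L) := by
  intro x
  obtain ⟨a, rfl⟩ := QuotientGroup.mk_surjective x
  refine hS.subgroup_mem _ (hS.conj_mem _ hL a) _ ?_
  intro g hg
  have hg' : ((g * a : G × G) : (G × G) ⧸ L) = (a : (G × G) ⧸ L) := hg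
  rw [eq_comm, QuotientGroup.eq] at hg'
  exact ⟨a⁻¹ * (g * a), hg', by simp [mul_assoc]⟩

/-- A non-empty biset is the coproduct of an orbit and a smaller biset. -/
theorem exists_iso_coprod [Finite G] (X : FinBiset G) (x : X.carrier) :
    ∃ Y : FinBiset G, Iso X (coprod (coset (MulAction.stabilizer (G × G) x)) Y) ∧
      Nat.card Y.carrier < Nat.card X.carrier ∧
      ∀ S, StabilizersIn S X → StabilizersIn S Y := by
  classical
  let N : SubMulAction (G × G) X.carrier :=
    { carrier := (MulAction.orbit (G × G) x)ᶜ
      smul_mem' := by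
        intro g y hy hgy
        refine hy ?_
        have h1 := MulAction.mem_orbit_of_mem_orbit (g⁻¹) hgy
        simpa using h1 }
  let Y : FinBiset G := { carrier := N }
  have hN : ∀ y : X.carrier, y ∈ N ↔ y ∉ MulAction.orbit (G × G) x := fun y => Iff.rfl
  let f : (coprod (coset (MulAction.stabilizer (G × G) x)) Y).carrier → X.carrier :=
    Sum.elim (MulAction.ofQuotientStabilizer (G × G) x) (fun y : N => (y : X.carrier))
  have hf : Function.Bijective f := by
    constructor
    · rintro (a | ⟨a, ha⟩) (b | ⟨b, hb⟩) hab
      · exact congrArg Sum.inl (MulAction.injective_ofQuotientStabilizer _ _ hab)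
      · refine absurd ?_ ((hN b).1 hb)
        have : MulAction.ofQuotientStabilizer (G × G) x a = b := hab
        rw [← this]
        exact MulAction.ofQuotientStabilizer_mem_orbit _ _ _
      · refine absurd ?_ ((hN a).1 ha)
        have : a = MulAction.ofQuotientStabilizer (G × G) x b := hab
        rw [this]
        exact MulAction.ofQuotientStabilizer_mem_orbit _ _ _
      · exact congrArg Sum.inr (Subtype.ext hab)
    · intro y
      by_cases hy : y ∈ MulAction.orbit (G × G) x
      · obtain ⟨g, rfl⟩ := hy
        exact ⟨Sum.inl (QuotientGroup.mk g), MulAction.ofQuotientStabilizer_mk _ _ g⟩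
      · exact ⟨Sum.inr ⟨y, hy⟩, rfl⟩
  refine ⟨Y, (isoSetoid G).symm ⟨Equiv.ofBijective f hf, ?_⟩, ?_, ?_⟩
  · rintro g (a | a)
    · exact MulAction.ofQuotientStabilizer_smul _ _ g a
    · rfl
  · exact Finite.card_subtype_lt (p := fun y => y ∈ N) (x := x)
      (fun h => (hN x).1 h (MulAction.mem_orbit_self x))
  · intro S hX y
    have h : MulAction.stabilizer (G × G) y =
        MulAction.stabilizer (G × G) ((y : N) : X.carrier) := by
      ext g
      exact Subtype.ext_iff
    rw [h]
    exact hX _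

end Laws

end FinBiset

/-! ### The double Burnside ring -/

/-- Isomorphism classes of finite `(G, G)`-bisets. -/
def BisetClass (G : Type u) [Group G] : Type (u + 1) := Quotient (FinBiset.isoSetoid G)

namespace BisetClass

/-- The isomorphism class of a biset. -/
def mk {G : Type u} [Group G] (X : FinBiset G) : BisetClass G := Quotient.mk _ X

theorem mk_eq {G : Type u} [Group G] {X Y : FinBiset G} : mk X = mk Y ↔ FinBiset.Iso X Y :=
  ⟨fun h => Quotient.exact h, fun h => Quotient.sound h⟩

theorem ind {G : Type u} [Group G] {p : BisetClass G → Prop} (h : ∀ X, p (mk X)) (a) : p a :=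
  Quotient.ind h a

variable {G : Type u} [Group G] [Finite G]

/-- Isomorphism classes form a monoid under the tensor product, with identity the class
of `G`. -/
instance : Monoid (BisetClass G) where
  mul := Quotient.map₂ FinBiset.tensor fun _ _ h _ _ k => FinBiset.tensor_congr h k
  one := mk (FinBiset.regular G)
  mul_assoc := by
    rintro ⟨X⟩ ⟨Y⟩ ⟨Z⟩
    exact mk_eq.2 (FinBiset.tensor_assoc X Y Z)
  one_mul := by
    rintro ⟨X⟩
    exact mk_eq.2 (FinBiset.regular_tensor X)
  mul_one := by
    rintro ⟨X⟩
    exact mk_eq.2 (FinBiset.tensor_regular X)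

theorem mk_mul (X Y : FinBiset G) : mk X * mk Y = mk (FinBiset.tensor X Y) := rfl

theorem one_def : (1 : BisetClass G) = mk (FinBiset.regular G) := rfl

end BisetClass

section Ring

variable (G : Type u) [Group G] [Finite G]

/-- The subgroup of the free abelian group on the isomorphism classes `{X}` generated by the
elements `{X ⨿ X'} - {X} - {X'}`. -/
def relSubgroup : AddSubgroup (FreeAbelianGroup (BisetClass G)) :=
  AddSubgroup.closure {a | ∃ X Y : FinBiset G,
    a = FreeAbelianGroup.of (BisetClass.mk (FinBiset.coprod X Y)) -
      FreeAbelianGroup.of (BisetClass.mk X) - FreeAbelianGroup.of (BisetClass.mk Y)}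

variable {G}

theorem mul_mem_relSubgroup (a : FreeAbelianGroup (BisetClass G))
    {b : FreeAbelianGroup (BisetClass G)} (hb : b ∈ relSubgroup G) : a * b ∈ relSubgroup G := by
  induction a using FreeAbelianGroup.induction_on with
  | zero => simp [zero_mem]
  | of Z =>
    induction Z using BisetClass.ind with
    | h Z =>
      induction hb using AddSubgroup.closure_induction with
      | mem b hb =>
        obtain ⟨X, Y, rfl⟩ := hb
        refine AddSubgroup.subset_closure ⟨FinBiset.tensor Z X, FinBiset.tensor Z Y, ?_⟩
        rw [mul_sub, mul_sub, FreeAbelianGroup.of_mul_of, FreeAbelianGroup.of_mul_of,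
          FreeAbelianGroup.of_mul_of, BisetClass.mk_mul, BisetClass.mk_mul, BisetClass.mk_mul,
          BisetClass.mk_eq.2 (FinBiset.tensor_coprod Z X Y)]
      | zero => simp [zero_mem]
      | add x y _ _ hx hy => rw [mul_add]; exact add_mem hx hy
      | neg x _ hx => rw [mul_neg]; exact neg_mem hx
  | neg x hx => rw [neg_mul]; exact neg_mem hx
  | add x y hx hy => rw [add_mul]; exact add_mem hx hy

theorem relSubgroup_mul_mem (a : FreeAbelianGroup (BisetClass G))
    {b : FreeAbelianGroup (BisetClass G)} (hb : b ∈ relSubgroup G) : b * a ∈ relSubgroup G := by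
  induction a using FreeAbelianGroup.induction_on with
  | zero => simp [zero_mem]
  | of Z =>
    induction Z using BisetClass.ind with
    | h Z =>
      induction hb using AddSubgroup.closure_induction with
      | mem b hb =>
        obtain ⟨X, Y, rfl⟩ := hb
        refine AddSubgroup.subset_closure ⟨FinBiset.tensor X Z, FinBiset.tensor Y Z, ?_⟩
        rw [sub_mul, sub_mul, FreeAbelianGroup.of_mul_of, FreeAbelianGroup.of_mul_of,
          FreeAbelianGroup.of_mul_of, BisetClass.mk_mul, BisetClass.mk_mul, BisetClass.mk_mul,
          BisetClass.mk_eq.2 (FinBiset.coprod_tensor X Y Z)]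
      | zero => simp [zero_mem]
      | add x y _ _ hx hy => rw [add_mul]; exact add_mem hx hy
      | neg x _ hx => rw [neg_mul]; exact neg_mem hx
  | neg x hx => rw [mul_neg]; exact neg_mem hx
  | add x y hx hy => rw [mul_add]; exact add_mem hx hy

variable (G)

/-- The subgroup of relations, as a two-sided ideal for the multiplication induced by the
tensor product of bisets. -/
def relIdeal : TwoSidedIdeal (FreeAbelianGroup (BisetClass G)) :=
  TwoSidedIdeal.mk' (relSubgroup G) (zero_mem _) add_mem neg_mem
    (fun h => mul_mem_relSubgroup _ h) (fun h => relSubgroup_mul_mem _ h)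

/-- The double Burnside ring `B(G, G)`: the Grothendieck group of finite `(G, G)`-bisets, with
the multiplication induced by the tensor product. -/
abbrev DoubleBurnside : Type (u + 1) := (relIdeal G).ringCon.Quotient

variable {G}

/-- The element `[X]` of `B(G, G)`. -/
def cls (X : FinBiset G) : DoubleBurnside G :=
  (relIdeal G).ringCon.mk' (FreeAbelianGroup.of (BisetClass.mk X))

theorem cls_eq_of_iso {X Y : FinBiset G} (h : FinBiset.Iso X Y) : cls X = cls Y := by
  rw [cls, cls, BisetClass.mk_eq.2 h]

theorem cls_mul (X Y : FinBiset G) : cls X * cls Y = cls (FinBiset.tensor X Y) := by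
  rw [cls, cls, ← map_mul, FreeAbelianGroup.of_mul_of]
  rfl

theorem cls_regular : cls (FinBiset.regular G) = 1 := by
  rw [cls, ← BisetClass.one_def, FreeAbelianGroup.of_one, map_one]

theorem cls_coprod (X Y : FinBiset G) : cls (FinBiset.coprod X Y) = cls X + cls Y := by
  rw [cls, cls, cls, ← map_add]
  refine (RingCon.eq _).2 ?_
  change _ - _ ∈ relSubgroup G
  rw [← sub_sub]
  exact AddSubgroup.subset_closure ⟨X, Y, rfl⟩

/-- The subgroup `B^S(G, G)` of `B(G, G)` spanned by the elements `[(G × G)/L]`, `L ∈ S`. -/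
def burnsideSubgroup (S : Set (Subgroup (G × G))) : AddSubgroup (DoubleBurnside G) :=
  AddSubgroup.closure {a | ∃ L ∈ S, a = cls (FinBiset.coset L)}

theorem cls_mem_burnsideSubgroup {S : Set (Subgroup (G × G))} (X : FinBiset G)
    (hX : FinBiset.StabilizersIn S X) : cls X ∈ burnsideSubgroup S := by
  induction hn : Nat.card X.carrier using Nat.strong_induction_on generalizing X with
  | _ n ih =>
    by_cases hne : Nonempty X.carrier
    · obtain ⟨x⟩ := hne
      obtain ⟨Y, hXY, hlt, hY⟩ := FinBiset.exists_iso_coprod X x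
      rw [cls_eq_of_iso hXY, cls_coprod]
      exact add_mem (AddSubgroup.subset_closure ⟨_, hX x, rfl⟩) (ih _ (hn ▸ hlt) Y (hY S hX) rfl)
    · have : IsEmpty X.carrier := not_nonempty_iff.1 hne
      have h : cls X = cls X + cls X := by
        rw [← cls_coprod]
        refine cls_eq_of_iso ⟨⟨isEmptyElim, Sum.elim isEmptyElim isEmptyElim, isEmptyElim, ?_⟩,
          fun _ => isEmptyElim⟩
        rintro (x | x) <;> exact isEmptyElim x
      rw [left_eq_add.1 h]
      exact zero_mem _

/-- The subring `B^S(G, G)` of `B(G, G)`. -/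
def burnsideSubring {S : Set (Subgroup (G × G))} (hS : IsStable S) :
    Subring (DoubleBurnside G) :=
  { burnsideSubgroup S with
    one_mem' := by
      rw [← cls_regular]
      exact cls_mem_burnsideSubgroup _ (FinBiset.StabilizersIn.regular hS)
    mul_mem' := by
      intro a b (ha : a ∈ burnsideSubgroup S) (hb : b ∈ burnsideSubgroup S)
      change a * b ∈ burnsideSubgroup S
      induction ha using AddSubgroup.closure_induction with
      | mem a ha =>
        obtain ⟨L, hL, rfl⟩ := ha
        induction hb using AddSubgroup.closure_induction with
        | mem b hb =>
          obtain ⟨M, hM, rfl⟩ := hb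
          rw [cls_mul]
          exact cls_mem_burnsideSubgroup _
            ((FinBiset.StabilizersIn.coset hS hL).tensor hS (FinBiset.StabilizersIn.coset hS hM))
        | zero => rw [mul_zero]; exact zero_mem _
        | add x y _ _ hx hy => rw [mul_add]; exact add_mem hx hy
        | neg x _ hx => rw [mul_neg]; exact neg_mem hx
      | zero => rw [zero_mul]; exact zero_mem _
      | add x y _ _ hx hy => rw [add_mul]; exact add_mem hx hy
      | neg x _ hx => rw [neg_mul]; exact neg_mem hx }

/-- The class `[X]` in `B^S(G, G)` of a biset `X` with point stabilizers in `S`. -/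
def clsS {S : Set (Subgroup (G × G))} (hS : IsStable S) (X : FinBiset G)
    (hX : FinBiset.StabilizersIn S X) : burnsideSubring hS :=
  ⟨cls X, cls_mem_burnsideSubgroup X hX⟩

/-- The `R`-algebra `R B^S(G, G) = R ⊗ B^S(G, G)`. -/
abbrev BurnsideAlgebra (R : Type w) [CommRing R] {S : Set (Subgroup (G × G))}
    (hS : IsStable S) : Type (max w (u + 1)) := R ⊗[ℤ] burnsideSubring hS

end Ring

/-! ### The category `S_G` -/

section Category

variable {G : Type u} [Group G]

/-- The morphisms `V → U` of the category `S_G` (objects: the subgroups of `G`): the homomorphisms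
`φ` with `{(φ(v), v) | v ∈ V} ∈ S`. -/
def homSet (S : Set (Subgroup (G × G))) (V U : Subgroup G) : Set (V →* U) :=
  {φ | graph (U.subtype.comp φ) ∈ S}

/-- `U` and `V` are isomorphic in the category `S_G`. -/
def IsoS (S : Set (Subgroup (G × G))) (U V : Subgroup G) : Prop :=
  ∃ e : U ≃* V, e.toMonoidHom ∈ homSet S U V ∧ e.symm.toMonoidHom ∈ homSet S V U

/-- `T` is a set of representatives of the isomorphism classes of objects of `S_G`. -/
def IsTransversal (S : Set (Subgroup (G × G))) (T : Set (Subgroup G)) : Prop :=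
  ∀ U : Subgroup G, ∃! V : Subgroup G, V ∈ T ∧ IsoS S U V

theorem graph_comp {S : Set (Subgroup (G × G))} (hS : IsStable S) {U V : Subgroup G}
    {φ : V →* G} {α : U →* V} (hφ : graph φ ∈ S) (hα : α ∈ homSet S U V) :
    graph (φ.comp α) ∈ S := by
  refine hS.subgroup_mem _ (hS.star_mem _ hφ _ hα) _ ?_
  rintro _ ⟨u, rfl⟩
  exact ⟨(α u : G), ⟨α u, rfl⟩, ⟨u, rfl⟩⟩

variable [Finite G]

/-- The group `Aut_{S_G}(U)` of automorphisms of `U` in the category `S_G`. -/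
def autS {S : Set (Subgroup (G × G))} (hS : IsStable S) (U : Subgroup G) :
    Subgroup (MulAut U) :=
  let M : Submonoid (MulAut U) :=
    { carrier := {e | e.toMonoidHom ∈ homSet S U U}
      one_mem' := by
        refine hS.subgroup_mem _ hS.diagonal_mem _ ?_
        rintro _ ⟨u, rfl⟩
        exact ⟨(u : G), rfl⟩
      mul_mem' := by
        intro a b ha hb
        exact graph_comp (φ := U.subtype.comp a.toMonoidHom) hS ha hb }
  { M with
    inv_mem' := by
      intro a ha
      have : Finite (MulAut U) := Finite.of_injective (fun e => (e : U → U)) DFunLike.coe_injective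
      have h : a⁻¹ ∈ Submonoid.powers a := by
        rw [mem_powers_iff_mem_zpowers]
        exact ⟨-1, by simp⟩
      exact (Submonoid.powers_le.2 (show a ∈ M from ha)) h }

/-- The group `Inn(U)` inside `Aut_{S_G}(U)`. -/
def innS {S : Set (Subgroup (G × G))} (hS : IsStable S) (U : Subgroup G) :
    Subgroup (autS hS U) :=
  (MulAut.conj : U →* MulAut U).range.subgroupOf (autS hS U)

theorem range_conj_le_autS {S : Set (Subgroup (G × G))} (hS : IsStable S) (U : Subgroup G) :
    (MulAut.conj : U →* MulAut U).range ≤ autS hS U := by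
  rintro _ ⟨a, rfl⟩
  refine hS.subgroup_mem _ (hS.conj_mem _ hS.diagonal_mem ((a : G), 1)) _ ?_
  rintro _ ⟨u, rfl⟩
  exact ⟨((u : G), (u : G)), ⟨(u : G), rfl⟩, by simp⟩

instance {S : Set (Subgroup (G × G))} (hS : IsStable S) (U : Subgroup G) :
    (innS hS U).Normal := by
  have : (MulAut.conj : U →* MulAut U).range.Normal := by
    constructor
    rintro _ ⟨a, rfl⟩ e
    exact ⟨e a, by ext; simp⟩
  exact Subgroup.normal_subgroupOf

/-- The group `Out_{S_G}(U) = Aut_{S_G}(U) / Inn(U)`. -/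
abbrev OutS {S : Set (Subgroup (G × G))} (hS : IsStable S) (U : Subgroup G) : Type u :=
  autS hS U ⧸ innS hS U

/-- `Hom_{S_G}(U, G)`: the homomorphisms `φ : U → G` with `{(φ(u), u) | u ∈ U} ∈ S`. -/
def HomG (S : Set (Subgroup (G × G))) (U : Subgroup G) : Type u :=
  {φ : U →* G // graph φ ∈ S}

/-- `φ` and `ψ` differ by an inner automorphism of `G`. -/
instance homSetoid (S : Set (Subgroup (G × G))) (U : Subgroup G) : Setoid (HomG S U) where
  r φ ψ := ∃ g : G, ∀ u : U, ψ.1 u = g * φ.1 u * g⁻¹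
  iseqv :=
    { refl := fun φ => ⟨1, by simp⟩
      symm := by
        rintro φ ψ ⟨g, hg⟩
        exact ⟨g⁻¹, fun u => by rw [hg]; group⟩
      trans := by
        rintro φ ψ χ ⟨g, hg⟩ ⟨h, hh⟩
        exact ⟨h * g, fun u => by rw [hh, hg]; group⟩ }

/-- The set of classes `Inn(G) \ Hom_{S_G}(U, G)`. -/
def HomBar (S : Set (Subgroup (G × G))) (U : Subgroup G) : Type u :=
  Quotient (homSetoid S U)

instance (S : Set (Subgroup (G × G))) (U : Subgroup G) : Finite (HomG S U) :=
  Finite.of_injective (fun φ => (φ.1 : U → G)) fun _ _ h => Subtype.ext (DFunLike.coe_injective h)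

instance (S : Set (Subgroup (G × G))) (U : Subgroup G) : Finite (HomBar S U) :=
  inferInstanceAs (Finite (Quotient (homSetoid S U)))

/-- The homomorphism `φ ∘ α`. -/
def HomG.precomp {S : Set (Subgroup (G × G))} (hS : IsStable S) {U : Subgroup G} (φ : HomG S U)
    (α : autS hS U) : HomG S U :=
  ⟨φ.1.comp α.1.toMonoidHom, graph_comp hS φ.2 α.2⟩

/-- The right action `[φ] [α] = [φ ∘ α]` of `Out_{S_G}(U)`, as a left action of the opposite
group. -/
instance {S : Set (Subgroup (G × G))} (hS : IsStable S) (U : Subgroup G) :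
    MulAction (OutS hS U)ᵐᵒᵖ (HomBar S U) where
  smul a := Quotient.map₂ (sa := QuotientGroup.leftRel (innS hS U))
    (sb := homSetoid S U) (sc := homSetoid S U)
    (fun (α : autS hS U) (φ : HomG S U) => φ.precomp hS α) (by
      intro α β hαβ φ ψ hφψ
      obtain ⟨g, hg⟩ := hφψ
      obtain ⟨c, hc⟩ := QuotientGroup.leftRel_apply.1 hαβ
      have hβ : ∀ u, β.1 u = α.1 (c * u * c⁻¹) := by
        intro u
        have h1 : (α⁻¹ * β).1 u = c * u * c⁻¹ := by
          rw [← MulAut.conj_apply]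
          exact (DFunLike.congr_fun hc u).symm
        rw [← h1]
        exact (MulEquiv.apply_symm_apply α.1 (β.1 u)).symm
      refine ⟨g * φ.1 (α.1 c), fun u => ?_⟩
      change ψ.1 (β.1 u) = _ * φ.1 (α.1 u) * _
      rw [hg, hβ]
      simp [mul_assoc]) a.unop
  one_smul := by
    rintro ⟨φ⟩
    rfl
  mul_smul := by
    rintro ⟨⟨α⟩⟩ ⟨⟨β⟩⟩ ⟨φ⟩
    rfl

end Category

/-! ### Modules -/

section Modules

variable {G : Type u} [Group G] [Finite G] (R : Type w) [Field R]
  {S : Set (Subgroup (G × G))} (hS : IsStable S) (U : Subgroup G)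

/-- The group algebra whose left modules are the right `R Out_{S_G}(U)`-modules. -/
abbrev OutAlgebra : Type (max w u) := MonoidAlgebra R (OutS hS U)ᵐᵒᵖ

/-- The right permutation `R Out_{S_G}(U)`-module with basis `Inn(G) \ Hom_{S_G}(U, G)`. -/
abbrev PermModule : Type (max u w) :=
  (Representation.ofMulAction R (OutS hS U)ᵐᵒᵖ (HomBar S U)).asModule

/-- A simple module over `A` in the universe of `A` (every simple module is isomorphic to a
quotient of `A`, hence to one of these). -/
abbrev SimpleModule (A : Type v) [Ring A] : Type (v + 1) :=
  {M : ModuleCat.{v} A // IsSimpleModule A M}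

instance simpleSetoid (A : Type v) [Ring A] : Setoid (SimpleModule A) where
  r M N := Nonempty (M.1 ≃ₗ[A] N.1)
  iseqv :=
    { refl := fun _ => ⟨LinearEquiv.refl _ _⟩
      symm := fun ⟨e⟩ => ⟨e.symm⟩
      trans := fun ⟨e⟩ ⟨f⟩ => ⟨e.trans f⟩ }

/-- Isomorphism classes of simple `A`-modules. -/
def SimpleClass (A : Type v) [Ring A] : Type (v + 1) := Quotient (simpleSetoid A)

/-- The isomorphism class of a simple module. -/
def SimpleClass.mk {A : Type v} [Ring A] (M : SimpleModule A) : SimpleClass A := Quotient.mk _ M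

/-- `V` is isomorphic to a direct summand of `P`. -/
def IsSummand (A : Type*) [Ring A] (V P : Type*) [AddCommGroup V] [Module A V]
    [AddCommGroup P] [Module A P] : Prop :=
  ∃ N N' : Submodule A P, IsCompl N N' ∧ Nonempty (V ≃ₗ[A] N)

/-- The isomorphism classes of simple right `R Out_{S_G}(U)`-modules that occur as a direct
summand of the permutation module. -/
def OccurringClass : Type (max u w + 1) :=
  {c : SimpleClass (OutAlgebra R hS U) // ∃ V : SimpleModule (OutAlgebra R hS U),
    SimpleClass.mk V = c ∧ IsSummand (OutAlgebra R hS U) V.1 (PermModule R hS U)}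

/-- The number `|X^L| / |C_G(φ(U))|` for `L = {(φ(u), ψ(u)) | u ∈ U}`. If `X` has twisted diagonal
stabilizers, then `C_G(φ(U))` acts freely on `X^L`, and the division is exact. -/
noncomputable def mark (X : FinBiset G) {U : Subgroup G} (φ ψ : U →* G) : ℕ :=
  Nat.card {x : X.carrier // ∀ u : U, ((φ u, ψ u) : G × G) • x = x} /
    Nat.card (Subgroup.centralizer (φ.range : Set G))

/-- The endomorphism `[ψ] ↦ ∑_[φ] |X^L| / |C_G(φ(U))| [φ]` of the permutation module. The
coefficients depend only on the classes of `φ` and `ψ`, and any representatives may be used. -/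
noncomputable def sigma (X : FinBiset G) : PermModule R hS U →ₗ[R] PermModule R hS U :=
  let e : PermModule R hS U ≃ₗ[R] (HomBar S U →₀ R) :=
    (Representation.ofMulAction R (OutS hS U)ᵐᵒᵖ (HomBar S U)).asModuleEquiv.trans
      (MonoidAlgebra.coeffLinearEquiv R)
  let f : (HomBar S U →₀ R) →ₗ[R] (HomBar S U →₀ R) :=
    Finsupp.linearCombination R fun ψ : HomBar S U =>
      Finsupp.equivFunOnFinite.symm fun φ : HomBar S U =>
        (mark X (Quotient.out φ).1 (Quotient.out ψ).1 : R)
  e.symm.toLinearMap ∘ₗ f ∘ₗ e.toLinearMap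

/-- The `R B^S(G, G)`-module `M` is isomorphic to the `R`-space of `R Out_{S_G}(U)`-linear maps
from `V` to the permutation module, on which the class of a biset `X` acts by composition with
`sigma X`. -/
def Corresponds (M : Type*) [AddCommGroup M] [Module (BurnsideAlgebra R hS) M]
    (V : Type*) [AddCommGroup V] [Module (OutAlgebra R hS U) V] : Prop :=
  ∃ f : M ≃+ (V →ₗ[OutAlgebra R hS U] PermModule R hS U),
    ∀ (r : R) (X : FinBiset G) (hX : FinBiset.StabilizersIn S X) (m : M) (x : V),
      f ((r ⊗ₜ[ℤ] clsS hS X hX : BurnsideAlgebra R hS) • m) x = r • sigma R hS U X (f m x)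

end Modules

end BurnsideRing

-- The theorem follows from an isomorphism of `R B^S(G,G)` with the product over `U ∈ T` of the
-- endomorphism rings of the permutation modules `R HomBar(U)` over `R Out(U)`.
--
-- As a vector space, the algebra is seen through its marks. The numbers `|X^L|`, `L ∈ S`, are
-- additive in `X` and depend only on the conjugacy class of `L`. The table of marks of the
-- transitive bisets is triangular for the order of `L`, and its diagonal entries `|N(L) : L|`
-- divide `|G × G|`. Since `|G|` is invertible, marks identify the algebra with the
-- conjugation-invariant functions on `S` (`exists_ghost_eq`, `eq_zero_of_ghost_eq_zero`).
--
-- Each `L ∈ S` has the form `{(φ(u), ψ(u)) | u ∈ U}` with a unique `U ∈ T` and with `φ, ψ ∈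
-- Hom_S(U, G)` unique up to a common automorphism of `U` in the category (`exists_pairGraph_eq`,
-- `exists_iso_of_pairGraph_eq`); closure under opposites makes every such pair admissible
-- (`pairGraph_mem`). So an invariant function on `S` is the same as a family of `Out(U)`-invariant
-- matrices indexed by `HomBar(U)`, that is, a family of `R Out(U)`-endomorphisms.
--
-- The factor `|C_G(φ(U))|⁻¹` makes this bijection multiplicative (`sigmaMatrix_mul`). A fixed point
-- of `X ×_G Y` determines, up to the free action of the middle group, a homomorphism `ψ : U → G`
-- and fixed points on `X` and `Y`; the conjugacy class of `ψ` has `|G| / |C_G(ψ(U))|` members.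
--
-- By Maschke's theorem the permutation modules are semisimple. Hence so is the product of their
-- endomorphism rings, and its simple modules are the spaces `Hom(V, P)` for the simple summands `V`
-- of a factor's module `P` (`exists_equiv_simpleClass`).

universe a b c d

namespace BurnsideRing

/-! ### Homomorphism spaces as modules over a ring of endomorphisms. -/

section HomModule

variable {A : Type a} [Ring A] {B : Type b} [Ring B] {P : Type c} [AddCommGroup P] [Module B P]

/-- The space of `B`-linear maps `V → P`, as a module over a ring `A` acting on `P` through a ring
homomorphism to `End_B(P)`. -/
def HomModule (_ : A →+* Module.End B P) (V : Type d) [AddCommGroup V] [Module B V] :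
    Type (max a c d) := ULift.{a} (V →ₗ[B] P)

namespace HomModule

variable (ρ : A →+* Module.End B P) (V : Type d) [AddCommGroup V] [Module B V]

instance : AddCommGroup (HomModule ρ V) := inferInstanceAs (AddCommGroup (ULift (V →ₗ[B] P)))

/-- The linear map underlying an element of `HomModule ρ V`. -/
def toHom : HomModule ρ V ≃+ (V →ₗ[B] P) := AddEquiv.ulift

instance : Module A (HomModule ρ V) where
  smul x f := (toHom ρ V).symm (ρ x ∘ₗ toHom ρ V f)
  one_smul f := by
    change (toHom ρ V).symm (ρ 1 ∘ₗ toHom ρ V f) = f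
    rw [map_one]
    exact (toHom ρ V).symm_apply_apply f
  mul_smul x y f := by
    change (toHom ρ V).symm (ρ (x * y) ∘ₗ toHom ρ V f) = (toHom ρ V).symm (ρ x ∘ₗ (ρ y ∘ₗ _))
    rw [map_mul]
    rfl
  smul_zero x := by
    change (toHom ρ V).symm (ρ x ∘ₗ toHom ρ V 0) = 0
    simp
  smul_add x f g := by
    change (toHom ρ V).symm (ρ x ∘ₗ toHom ρ V (f + g)) =
      (toHom ρ V).symm (ρ x ∘ₗ toHom ρ V f) + (toHom ρ V).symm (ρ x ∘ₗ toHom ρ V g)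
    simp [LinearMap.comp_add]
  add_smul x y f := by
    change (toHom ρ V).symm (ρ (x + y) ∘ₗ toHom ρ V f) =
      (toHom ρ V).symm (ρ x ∘ₗ toHom ρ V f) + (toHom ρ V).symm (ρ y ∘ₗ toHom ρ V f)
    simp [LinearMap.add_comp]
  zero_smul f := by
    change (toHom ρ V).symm (ρ 0 ∘ₗ toHom ρ V f) = 0
    simp

variable {ρ V}

theorem toHom_smul (x : A) (f : HomModule ρ V) : toHom ρ V (x • f) = ρ x ∘ₗ toHom ρ V f := rfl

/-- Functoriality of `HomModule` under isomorphisms. -/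
def congr {W : Type d} [AddCommGroup W] [Module B W] (e : V ≃ₗ[B] W) :
    HomModule ρ V ≃ₗ[A] HomModule ρ W where
  toFun f := (toHom ρ W).symm (toHom ρ V f ∘ₗ e.symm.toLinearMap)
  invFun f := (toHom ρ V).symm (toHom ρ W f ∘ₗ e.toLinearMap)
  map_add' f g := by simp [LinearMap.add_comp]
  map_smul' x f := by
    apply (toHom ρ W).injective
    ext v
    simp [toHom_smul]
  left_inv f := by
    apply (toHom ρ V).injective
    ext v
    simp
  right_inv f := by
    apply (toHom ρ W).injective
    ext v
    simp

/-- A nonzero map `f : V → P` is injective because `V` is simple. Every other map `g : V → P` then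
extends along `f` to an endomorphism of the semisimple module `P`, and that endomorphism comes from
`A`. So each nonzero element generates. -/
theorem isSimpleModule [IsSemisimpleModule B P] [IsSimpleModule B V]
    (hρ : Function.Surjective ρ) (hV : ∃ f : V →ₗ[B] P, f ≠ 0) :
    IsSimpleModule A (HomModule ρ V) := by
  rw [isSimpleModule_iff_toSpanSingleton_surjective]
  constructor
  · obtain ⟨f, hf⟩ := hV
    exact ⟨(toHom ρ V).symm f, 0, by simpa using hf⟩
  · intro f hf g
    have hf' : toHom ρ V f ≠ 0 := by simpa using hf
    obtain ⟨h, hh⟩ := IsSemisimpleModule.extension_property (toHom ρ V f)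
      (LinearMap.injective_of_ne_zero hf') (toHom ρ V g)
    obtain ⟨x, rfl⟩ := hρ h
    exact ⟨x, (toHom ρ V).injective hh⟩

/-- A simple `B`-module that embeds into `P` is determined by the `A`-module `Hom_B(V, P)`. -/
theorem nonempty_equiv [IsSemisimpleModule B P] [IsSimpleModule B V] {W : Type d} [AddCommGroup W]
    [Module B W] [IsSimpleModule B W] (hρ : Function.Surjective ρ) (hV : ∃ f : V →ₗ[B] P, f ≠ 0)
    (e : HomModule ρ V ≃ₗ[A] HomModule ρ W) : Nonempty (V ≃ₗ[B] W) := by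
  obtain ⟨f, hf⟩ := hV
  have hinj := LinearMap.injective_of_ne_zero hf
  -- With `r` a retraction of `f`, the element `x` acts as the projection `f ∘ r` onto the copy
  -- `f(V)` and fixes `f`. An `A`-isomorphism preserves this, so the image `g` of `f` satisfies `g =
  -- f ∘ r ∘ g`, which forces `r ∘ g : W → V` to be nonzero.
  obtain ⟨r, hr⟩ := IsSemisimpleModule.extension_property f hinj (LinearMap.id)
  obtain ⟨x, hx⟩ := hρ (f ∘ₗ r)
  have h1 : x • (toHom ρ V).symm f = (toHom ρ V).symm f := by
    apply (toHom ρ V).injective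
    rw [toHom_smul, hx, AddEquiv.apply_symm_apply, LinearMap.comp_assoc, hr, LinearMap.comp_id]
  have h2 : x • e ((toHom ρ V).symm f) = e ((toHom ρ V).symm f) := by rw [← map_smul, h1]
  set g := toHom ρ W (e ((toHom ρ V).symm f)) with hg
  have h3 : f ∘ₗ (r ∘ₗ g) = g := by
    rw [← LinearMap.comp_assoc, ← hx]
    exact congrArg (toHom ρ W) h2
  have h4 : r ∘ₗ g ≠ 0 := by
    intro h
    rw [h, LinearMap.comp_zero] at h3
    rw [hg, eq_comm, AddEquivClass.map_eq_zero_iff, LinearEquiv.map_eq_zero_iff,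
      AddEquivClass.map_eq_zero_iff] at h3
    exact hf h3
  exact ⟨(LinearEquiv.ofBijective _ (LinearMap.bijective_of_ne_zero h4)).symm⟩

end HomModule

theorem IsSummand.exists_ne_zero {B : Type*} [Ring B] {V P : Type*} [AddCommGroup V] [Module B V]
    [AddCommGroup P] [Module B P] [IsSimpleModule B V] (h : IsSummand B V P) :
    ∃ f : V →ₗ[B] P, f ≠ 0 := by
  obtain ⟨N, _, _, ⟨e⟩⟩ := h
  have := IsSimpleModule.nontrivial B V
  obtain ⟨v, hv⟩ := exists_ne (0 : V)
  refine ⟨N.subtype ∘ₗ e.toLinearMap, fun h => hv ?_⟩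
  simpa using DFunLike.congr_fun h v

theorem isSummand_of_injective {B : Type*} [Ring B] {V P : Type*} [AddCommGroup V] [Module B V]
    [AddCommGroup P] [Module B P] [IsSemisimpleModule B P] (f : V →ₗ[B] P)
    (hf : Function.Injective f) : IsSummand B V P := by
  obtain ⟨N', h⟩ := exists_isCompl (LinearMap.range f)
  exact ⟨_, N', h, ⟨LinearEquiv.ofInjective f hf⟩⟩

theorem SimpleClass.mk_eq {A : Type v} [Ring A] {M N : SimpleModule A} :
    SimpleClass.mk M = SimpleClass.mk N ↔ Nonempty (M.1 ≃ₗ[A] N.1) :=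
  ⟨fun h => Quotient.exact h, fun h => Quotient.sound h⟩

end HomModule

/-! ### Simple modules of a finite product of endomorphism rings. -/

section EndomorphismProduct

variable {ι : Type c} {A : Type (max a b)} [Ring A] {B : ι → Type b} [∀ i, Ring (B i)]
  {P : ι → Type b} [∀ i, AddCommGroup (P i)] [∀ i, Module (B i) (P i)]

theorem isSemisimpleRing_of_ringEquiv_pi_end [Finite ι] [∀ i, IsSemisimpleModule (B i) (P i)]
    [∀ i, Module.Finite (B i) (P i)] (σ : A ≃+* Π i, Module.End (B i) (P i)) :
    IsSemisimpleRing A :=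
  have (i : ι) : IsSemisimpleRing (Module.End (B i) (P i)) := IsSemisimpleRing.moduleEnd _ _
  σ.symm.isSemisimpleRing

variable (σ : A ≃+* Π i, Module.End (B i) (P i))

/-- The action of `A` on `P i`. -/
def componentHom (i : ι) : A →+* Module.End (B i) (P i) := (Pi.evalRingHom _ i).comp σ.toRingHom

theorem componentHom_apply (i : ι) (x : A) : componentHom σ i x = σ x i := rfl

theorem componentHom_surjective (i : ι) : Function.Surjective (componentHom σ i) := by
  classical
  intro f
  exact ⟨σ.symm (Pi.single i f), by simp [componentHom_apply]⟩

/-- The central idempotent of the factor `i` acts as the identity on the first module; if `i ≠ i'`,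
it acts as zero on the second, although the first module is nonzero. -/
theorem eq_of_homModule_equiv {i i' : ι} {V : Type*} [AddCommGroup V] [Module (B i) V]
    {V' : Type*} [AddCommGroup V'] [Module (B i') V'] (hV : ∃ f : V →ₗ[B i] P i, f ≠ 0)
    (e : HomModule (componentHom σ i) V ≃ₗ[A] HomModule (componentHom σ i') V') : i = i' := by
  classical
  by_contra hii
  obtain ⟨f, hf⟩ := hV
  set x := σ.symm (Pi.single i 1)
  set f' := (HomModule.toHom (componentHom σ i) V).symm f
  have h1 : x • f' = f' := by
    apply (HomModule.toHom _ _).injective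
    rw [HomModule.toHom_smul, componentHom_apply, RingEquiv.apply_symm_apply, Pi.single_eq_same]
    rfl
  have h2 : x • e f' = 0 := by
    apply (HomModule.toHom _ _).injective
    rw [HomModule.toHom_smul, componentHom_apply, RingEquiv.apply_symm_apply,
      Pi.single_eq_of_ne (Ne.symm hii), LinearMap.zero_comp, map_zero]
  rw [← map_smul, h1] at h2
  apply hf
  simpa [f'] using h2

variable [Finite ι] [∀ i, IsSemisimpleModule (B i) (P i)] [∀ i, Module.Finite (B i) (P i)]

/-- Every simple module over a finite product of endomorphism rings of semisimple modules of
finite length is a space of homomorphisms from a simple module. -/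
theorem exists_homModule_equiv (M : Type*) [AddCommGroup M] [Module A M] [IsSimpleModule A M] :
    ∃ (i : ι) (N : Submodule (B i) (P i)), IsSimpleModule (B i) N ∧
      Nonempty (HomModule (componentHom σ i) N ≃ₗ[A] M) := by
  classical
  have := Fintype.ofFinite ι
  have := IsSimpleModule.nontrivial A M
  obtain ⟨m, hm⟩ := exists_ne (0 : M)
  have hone : (1 : A) = ∑ i, σ.symm (Pi.single i 1) := by
    rw [← map_sum, Finset.univ_sum_single]
    exact (map_one σ.symm).symm
  -- The central idempotents of the factors sum to `1`, so one of them does not kill `m`.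
  obtain ⟨i, hi⟩ : ∃ i, σ.symm (Pi.single i 1) • m ≠ 0 := by
    by_contra! h
    apply hm
    rw [← one_smul A m, hone, Finset.sum_smul]
    exact Finset.sum_eq_zero fun i _ => h i
  obtain ⟨n, N, e, hN⟩ := IsSemisimpleModule.exists_linearEquiv_fin_dfinsupp (B i) (P i)
  let p (k : Fin n) : P i →ₗ[B i] N k := DFinsupp.lapply k ∘ₗ e.toLinearMap
  let j (k : Fin n) : N k →ₗ[B i] P i :=
    e.symm.toLinearMap ∘ₗ DFinsupp.lsingle (R := B i) (M := fun k => N k) k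
  have hsum : (1 : Module.End (B i) (P i)) = ∑ k, j k ∘ₗ p k := by
    ext x
    rw [LinearMap.sum_apply]
    apply e.injective
    simp only [Module.End.one_apply, LinearMap.comp_apply, LinearEquiv.coe_coe, map_sum,
      LinearEquiv.apply_symm_apply, p, j, DFinsupp.lapply_apply, DFinsupp.lsingle_apply]
    ext k
    simp [DFinsupp.single_apply]
  -- The same argument inside the factor `i`: the projections of `P i` onto its simple constituents
  -- sum to `1`, so one of them moves `m` to a nonzero element.
  obtain ⟨k, hk⟩ : ∃ k, σ.symm (Pi.single i (j k ∘ₗ p k)) • m ≠ 0 := by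
    by_contra! h
    apply hi
    have : (Pi.single i 1 : Π i, Module.End (B i) (P i)) =
        ∑ k, Pi.single i (j k ∘ₗ p k) := by
      rw [hsum]
      exact map_sum (AddMonoidHom.single (fun i => Module.End (B i) (P i)) i) _ _
    rw [this, map_sum, Finset.sum_smul]
    exact Finset.sum_eq_zero fun k _ => h k
  have := hN k
  have hj : j k ≠ 0 := by
    intro h
    apply hk
    simp [h]
  have := HomModule.isSimpleModule (componentHom_surjective σ i) ⟨j k, hj⟩
  -- A map `h : N k → P i` becomes the endomorphism `h ∘ p k`, which is applied to `m`. The value at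
  -- `j k` is the nonzero element of `hk`, so `F` is a nonzero map between simple modules and
  -- Schur's lemma applies.
  let F : HomModule (componentHom σ i) (N k) →ₗ[A] M :=
    { toFun := fun h => σ.symm (Pi.single i (HomModule.toHom _ _ h ∘ₗ p k)) • m
      map_add' := by
        intro f g
        rw [map_add, LinearMap.add_comp, Pi.single_add, map_add, add_smul]
      map_smul' := by
        intro x f
        rw [RingHom.id_apply, smul_smul]
        congr 1
        apply σ.injective
        rw [map_mul, RingEquiv.apply_symm_apply, RingEquiv.apply_symm_apply, HomModule.toHom_smul,
          componentHom_apply, LinearMap.comp_assoc, ← Pi.single_mul_right]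
        rfl }
  have hF : F ≠ 0 := by
    intro h
    apply hk
    exact DFunLike.congr_fun h ((HomModule.toHom _ _).symm (j k))
  exact ⟨i, N k, hN k, ⟨LinearEquiv.ofBijective F (LinearMap.bijective_of_ne_zero hF)⟩⟩

/-- The simple modules of a finite product of endomorphism rings `End_{B i}(P i)` of semisimple
modules of finite length are the spaces `Hom_{B i}(V, P i)` for the simple summands `V`
of `P i`. -/
theorem exists_equiv_simpleClass :
    ∃ e : (Σ i, {c : SimpleClass (B i) // ∃ V : SimpleModule (B i),
        SimpleClass.mk V = c ∧ IsSummand (B i) V.1 (P i)}) ≃ SimpleClass A,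
      ∀ i c (V : SimpleModule (B i)) (M : SimpleModule A), SimpleClass.mk V = c.1 →
        SimpleClass.mk M = e ⟨i, c⟩ →
        ∃ f : M.1 ≃+ (V.1 →ₗ[B i] P i), ∀ x m, f (x • m) = σ x i ∘ₗ f m := by
  let C := Σ i, {c : SimpleClass (B i) // ∃ V : SimpleModule (B i),
        SimpleClass.mk V = c ∧ IsSummand (B i) V.1 (P i)}
  let rep (s : C) : SimpleModule (B s.1) := s.2.2.choose
  have hrep (s : C) : SimpleClass.mk (rep s) = s.2.1 := s.2.2.choose_spec.1
  have hsimple (s : C) : IsSimpleModule (B s.1) (rep s).1 := (rep s).2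
  have hsum (s : C) : ∃ f : (rep s).1 →ₗ[B s.1] P s.1, f ≠ 0 :=
    s.2.2.choose_spec.2.exists_ne_zero
  -- The lift in `HomModule` places the space of maps in the universe of `A`, as `SimpleModule A`
  -- demands.
  let F (s : C) : SimpleModule A :=
    ⟨ModuleCat.of A (HomModule (componentHom σ s.1) (rep s).1),
      HomModule.isSimpleModule (componentHom_surjective σ s.1) (hsum s)⟩
  have hF : Function.Bijective fun s => SimpleClass.mk (F s) := by
    constructor
    · intro s s' h
      obtain ⟨e⟩ := SimpleClass.mk_eq.1 h
      have h1 : s.1 = s'.1 := eq_of_homModule_equiv σ (hsum s) e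
      obtain ⟨i, c⟩ := s
      obtain ⟨i', c'⟩ := s'
      obtain rfl : i = i' := h1
      have := hsimple ⟨i, c⟩
      have := hsimple ⟨i, c'⟩
      have h2 := HomModule.nonempty_equiv (componentHom_surjective σ i) (hsum ⟨i, c⟩) e
      have h3 : c = c' := Subtype.ext <| by
        rw [← hrep ⟨i, c⟩, ← hrep ⟨i, c'⟩]
        exact SimpleClass.mk_eq.2 h2
      rw [h3]
    · intro c
      obtain ⟨M, rfl⟩ : ∃ M, SimpleClass.mk M = c := Quotient.exists_rep c
      have := M.2
      obtain ⟨i, N, hN, ⟨e⟩⟩ := exists_homModule_equiv σ M.1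
      let V : SimpleModule (B i) := ⟨ModuleCat.of (B i) N, hN⟩
      let s : C := ⟨i, SimpleClass.mk V, V, rfl, isSummand_of_injective N.subtype
        N.injective_subtype⟩
      obtain ⟨e'⟩ := SimpleClass.mk_eq.1 (hrep s)
      exact ⟨s, SimpleClass.mk_eq.2 ⟨(HomModule.congr e').trans e⟩⟩
  refine ⟨Equiv.ofBijective _ hF, fun i c V M hV hM => ?_⟩
  obtain ⟨e⟩ := SimpleClass.mk_eq.1 hM
  -- The bijection was built from chosen representatives; an isomorphism from the chosen one to `V`
  -- transports the description to every module in the class.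
  obtain ⟨e'⟩ := SimpleClass.mk_eq.1 ((hrep ⟨i, c⟩).trans hV.symm)
  let g := e.trans (HomModule.congr (ρ := componentHom σ i) e')
  refine ⟨g.toAddEquiv.trans (HomModule.toHom _ _), fun x m => ?_⟩
  change HomModule.toHom _ _ (g (x • m)) = _
  rw [map_smul, HomModule.toHom_smul]
  rfl

end EndomorphismProduct

/-! ### Fixed points of bisets -/

section FixedPoints

variable {G : Type u} [Group G]

/-- The subgroup `{(φ(u), ψ(u)) | u ∈ U}`. -/
def pairGraph {U : Type*} [Group U] (φ ψ : U →* G) : Subgroup (G × G) := (φ.prod ψ).range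

/-- The number of fixed points of `L` on `X`. -/
noncomputable def fixCount (X : FinBiset G) (L : Subgroup (G × G)) : ℕ :=
  Nat.card {x : X.carrier // ∀ g ∈ L, g • x = x}

theorem fixCount_pairGraph (X : FinBiset G) {U : Type*} [Group U] (φ ψ : U →* G) :
    fixCount X (pairGraph φ ψ) =
      Nat.card {x : X.carrier // ∀ u : U, ((φ u, ψ u) : G × G) • x = x} := by
  refine Nat.card_congr (Equiv.subtypeEquivRight fun x => ?_)
  constructor
  · exact fun h u => h _ ⟨u, rfl⟩
  · rintro h _ ⟨u, rfl⟩
    exact h u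

theorem fixCount_congr {X Y : FinBiset G} (h : FinBiset.Iso X Y) (L : Subgroup (G × G)) :
    fixCount X L = fixCount Y L := by
  obtain ⟨e, he⟩ := h
  refine Nat.card_congr (e.subtypeEquiv fun x => ?_)
  refine forall₂_congr fun g _ => ?_
  rw [← he, e.apply_eq_iff_eq]

theorem fixCount_coprod (X Y : FinBiset G) (L : Subgroup (G × G)) :
    fixCount (FinBiset.coprod X Y) L = fixCount X L + fixCount Y L := by
  rw [fixCount, fixCount, fixCount, ← Nat.card_sum]
  refine Nat.card_congr ((Equiv.subtypeSum).trans (Equiv.sumCongr ?_ ?_))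
  · exact Equiv.subtypeEquivRight fun x => forall₂_congr fun g _ => Sum.inl_injective.eq_iff
  · exact Equiv.subtypeEquivRight fun x => forall₂_congr fun g _ => Sum.inr_injective.eq_iff

theorem fixCount_conjugate (X : FinBiset G) (a : G × G) (L : Subgroup (G × G)) :
    fixCount X (conjugate a L) = fixCount X L := by
  refine (Nat.card_congr ((MulAction.toPerm a).subtypeEquiv fun x => ?_)).symm
  have h (g : G × G) : (a * g * a⁻¹) • a • x = a • x ↔ g • x = x := by
    rw [smul_smul, inv_mul_cancel_right, mul_smul, smul_left_cancel_iff]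
  constructor
  · rintro hx _ ⟨g, hg, rfl⟩
    exact (h g).2 (hx g hg)
  · intro hx g hg
    exact (h g).1 (hx _ ⟨g, hg, rfl⟩)

theorem conjugate_pairGraph {U : Type*} [Group U] {φ ψ φ' ψ' : U →* G} {g h : G}
    (hφ : ∀ u, φ' u = g * φ u * g⁻¹) (hψ : ∀ u, ψ' u = h * ψ u * h⁻¹) :
    pairGraph φ' ψ' = conjugate (g, h) (pairGraph φ ψ) := by
  ext x
  constructor
  · rintro ⟨u, rfl⟩
    refine ⟨(φ u, ψ u), ⟨u, rfl⟩, ?_⟩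
    ext
    · exact (hφ u).symm
    · exact (hψ u).symm
  · rintro ⟨_, ⟨u, rfl⟩, rfl⟩
    refine ⟨u, ?_⟩
    ext
    · exact hφ u
    · exact hψ u

theorem pairGraph_comp {U V : Type*} [Group U] [Group V] (φ ψ : V →* G) {α : U →* V}
    (hα : Function.Surjective α) : pairGraph (φ.comp α) (ψ.comp α) = pairGraph φ ψ := by
  ext x
  constructor
  · rintro ⟨u, rfl⟩
    exact ⟨α u, rfl⟩
  · rintro ⟨v, rfl⟩
    obtain ⟨u, rfl⟩ := hα v
    exact ⟨u, rfl⟩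

theorem conjugate_mul (a b : G) (L : Subgroup G) :
    conjugate (a * b) L = conjugate a (conjugate b L) := by
  rw [conjugate, conjugate, conjugate, Subgroup.map_map, map_mul]
  rfl

theorem conjugate_one (L : Subgroup G) : conjugate 1 L = L := by
  rw [conjugate, map_one]
  exact Subgroup.map_id L

theorem card_conjugate (a : G) (L : Subgroup G) : Nat.card (conjugate a L) = Nat.card L :=
  Nat.card_congr (L.equivMapOfInjective _ (MulAut.conj a).injective).symm.toEquiv

end FixedPoints

/-! ### Marks as additive functions on the double Burnside ring. -/

section Marks

variable {G : Type u} [Group G] [Finite G]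

/-- The mark of `L`: the additive map `[X] ↦ |X^L|` on the double Burnside ring. -/
noncomputable def markHom (L : Subgroup (G × G)) : DoubleBurnside G →+ ℤ :=
  let f : FreeAbelianGroup (BisetClass G) →+ ℤ :=
    FreeAbelianGroup.lift (Quotient.lift (fun X : FinBiset G => (fixCount X L : ℤ))
      fun _ _ h => congrArg Nat.cast (fixCount_congr h L))
  have hf : relSubgroup G ≤ f.ker := by
    refine (AddSubgroup.closure_le _).2 ?_
    rintro _ ⟨X, Y, rfl⟩
    change f (_ - _ - _) = 0
    rw [map_sub, map_sub]
    simp only [f]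
    change (fixCount (FinBiset.coprod X Y) L : ℤ) - fixCount X L - fixCount Y L = 0
    rw [fixCount_coprod]
    push_cast
    ring
  { toFun := Quotient.lift f fun a b h => by
      have h' : a - b ∈ relSubgroup G := h
      exact sub_eq_zero.1 ((map_sub f a b).symm.trans (hf h'))
    map_zero' := map_zero f
    map_add' := by
      rintro ⟨a⟩ ⟨b⟩
      exact map_add f a b }

theorem markHom_cls (L : Subgroup (G × G)) (X : FinBiset G) : markHom L (cls X) = fixCount X L :=
  FreeAbelianGroup.lift_apply_of _ _

end Marks

/-! ### Bifree bisets -/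

section Bifree

variable {G : Type u} [Group G]

theorem IsTwistedDiagonal.eq_one_right {L : Subgroup (G × G)} (hL : IsTwistedDiagonal L) {h : G}
    (hh : ((1, h) : G × G) ∈ L) : h = 1 := by
  obtain ⟨U, V, α, rfl⟩ := hL
  obtain ⟨v, hv⟩ := hh
  have h1 : ((α v : U) : G) = 1 := congrArg Prod.fst hv
  have h2 : (v : G) = h := congrArg Prod.snd hv
  rw [OneMemClass.coe_eq_one, EmbeddingLike.map_eq_one_iff] at h1
  rw [← h2, h1, OneMemClass.coe_one]

theorem IsTwistedDiagonal.eq_one_left {L : Subgroup (G × G)} (hL : IsTwistedDiagonal L) {g : G}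
    (hg : ((g, 1) : G × G) ∈ L) : g = 1 := by
  obtain ⟨U, V, α, rfl⟩ := hL
  obtain ⟨v, hv⟩ := hg
  have h1 : ((α v : U) : G) = g := congrArg Prod.fst hv
  have h2 : (v : G) = 1 := congrArg Prod.snd hv
  rw [OneMemClass.coe_eq_one] at h2
  rw [← h1, h2, map_one, OneMemClass.coe_one]

variable {S : Set (Subgroup (G × G))} (hΔ : ∀ L ∈ S, IsTwistedDiagonal L) {X : FinBiset G}
  (hX : FinBiset.StabilizersIn S X)

include hΔ hX

/-- The right action on `X` is free. In the fixed-point count for `X ×_G Y` this makes the element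
of the middle group unique, and so turns a choice of such elements into a homomorphism. -/
theorem eq_of_smul_eq_right {x : X.carrier} {g h h' : G} (h1 : ((g, h) : G × G) • x = x)
    (h2 : ((g, h') : G × G) • x = x) : h = h' := by
  have h3 : ((1, h⁻¹ * h') : G × G) ∈ MulAction.stabilizer (G × G) x := by
    have := (MulAction.stabilizer (G × G) x).mul_mem
      ((MulAction.stabilizer (G × G) x).inv_mem h1) h2
    simpa using this
  have h4 := (hΔ _ (hX x)).eq_one_right h3
  rwa [inv_mul_eq_one] at h4

theorem eq_one_of_smul_eq {x : X.carrier} {g : G} (h1 : ((g, 1) : G × G) • x = x) : g = 1 :=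
  (hΔ _ (hX x)).eq_one_left h1

/-- The centralizer of `φ(U)` acts freely on the fixed points of `{(φ(u), ψ(u)) | u ∈ U}`. -/
theorem card_centralizer_dvd_fixCount {U : Type*} [Group U] (φ ψ : U →* G) :
    Nat.card (Subgroup.centralizer (φ.range : Set G)) ∣ fixCount X (pairGraph φ ψ) := by
  rw [fixCount_pairGraph]
  let C := Subgroup.centralizer (φ.range : Set G)
  have hC (c : C) (u : U) : φ u * (c : G) = c * φ u :=
    Subgroup.mem_centralizer_iff.1 c.2 _ ⟨u, rfl⟩
  let act : MulAction C {x : X.carrier // ∀ u : U, ((φ u, ψ u) : G × G) • x = x} :=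
    { smul := fun c x => ⟨(((c : G), 1) : G × G) • x.1, fun u => by
        have := x.2 u
        rw [smul_smul, Prod.mk_mul_mk, hC, mul_one, ← one_mul (ψ u), ← Prod.mk_mul_mk, mul_smul,
          this]⟩
      one_smul := fun x => Subtype.ext (one_smul (G × G) x.1)
      mul_smul := fun c d x => Subtype.ext <| by
        change ((((c * d : C) : G), 1) : G × G) • x.1 = ((c : G), (1 : G)) • ((d : G), (1 : G)) • x.1
        rw [smul_smul, Prod.mk_mul_mk, mul_one]
        rfl }
  have hfree (x : {x : X.carrier // ∀ u : U, ((φ u, ψ u) : G × G) • x = x}) :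
      MulAction.stabilizer C x = ⊥ := by
    rw [eq_bot_iff]
    intro c hc
    have h1 : (((c : G), 1) : G × G) • x.1 = x.1 := congrArg Subtype.val hc
    exact Subtype.ext (eq_one_of_smul_eq hΔ hX h1)
  rw [Nat.card_congr (MulAction.selfEquivOrbitsQuotientProd hfree), Nat.card_prod]
  exact Dvd.intro_left _ rfl

variable {Y : FinBiset G} (hY : FinBiset.StabilizersIn S Y)

/-- The middle group acts freely on `X × Y`. -/
theorem card_fiber_tmk (p : (FinBiset.tensor X Y).carrier → Prop) :
    Nat.card {z : X.carrier × Y.carrier // p (FinBiset.tmk z.1 z.2)} =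
      Nat.card G * Nat.card {t // p t} := by
  rw [← Nat.card_prod]
  have hout (t : (FinBiset.tensor X Y).carrier) :
      FinBiset.tmk (Quotient.out t).1 (Quotient.out t).2 = t := Quotient.out_eq t
  have htmk (h : G) (x : X.carrier) (y : Y.carrier) :
      FinBiset.tmk (((1, h) : G × G) • x) (((h, 1) : G × G) • y) = FinBiset.tmk x y :=
    (FinBiset.tmk_eq.2 ⟨h, rfl, rfl⟩).symm
  -- Each `t` has a chosen representative pair, and `h` runs through its orbit under the middle
  -- group. Freeness on `X` alone makes this parametrization injective.
  let f (a : G × {t // p t}) : {z : X.carrier × Y.carrier // p (FinBiset.tmk z.1 z.2)} :=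
    ⟨(((1, a.1) : G × G) • (Quotient.out a.2.1).1, ((a.1, 1) : G × G) • (Quotient.out a.2.1).2), by
      rw [htmk, hout]
      exact a.2.2⟩
  refine (Nat.card_congr (Equiv.ofBijective f ⟨?_, ?_⟩)).symm
  · rintro ⟨g, t, ht⟩ ⟨h, s, hs⟩ hab
    have h1 : ((1, g) : G × G) • (Quotient.out t).1 = ((1, h) : G × G) • (Quotient.out s).1 :=
      congrArg (fun z => z.1.1) hab
    have h2 : ((g, 1) : G × G) • (Quotient.out t).2 = ((h, 1) : G × G) • (Quotient.out s).2 :=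
      congrArg (fun z => z.1.2) hab
    have hts : t = s := by
      rw [← hout t, ← hout s, ← htmk g, h1, h2, htmk]
    subst hts
    have h3 : ((1, h⁻¹ * g) : G × G) • (Quotient.out t).1 = (Quotient.out t).1 := by
      have := congrArg (fun x => ((1, h) : G × G)⁻¹ • x) h1
      simpa [smul_smul, ← Prod.one_eq_mk] using this
    have h4 := (hΔ _ (hX _)).eq_one_right h3
    rw [inv_mul_eq_one] at h4
    rw [h4]
  · rintro ⟨⟨x, y⟩, hz⟩
    obtain ⟨h, h1, h2⟩ := FinBiset.tmk_eq.1 (hout (FinBiset.tmk x y))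
    exact ⟨⟨h, FinBiset.tmk x y, hz⟩, Subtype.ext (Prod.ext h1.symm h2.symm)⟩

variable (hS : IsStable S)
include hY hS

/-- The fixed points of `X ×_G Y`, counted through the homomorphisms to the middle group. -/
theorem card_mul_fixCount_tensor [Finite G] {U : Subgroup G} [Fintype (HomG S U)] (φ : U →* G)
    (χ : HomG S U) :
    Nat.card G * fixCount (FinBiset.tensor X Y) (pairGraph φ χ.1) =
      ∑ ψ : HomG S U, fixCount X (pairGraph φ ψ.1) * fixCount Y (pairGraph ψ.1 χ.1) := by
  have h := card_fiber_tmk hΔ hX (Y := Y) fun t => ∀ u : U, ((φ u, χ.1 u) : G × G) • t = t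
  rw [← fixCount_pairGraph (FinBiset.tensor X Y)] at h
  simp only [fixCount_pairGraph X, fixCount_pairGraph Y, ← Nat.card_prod]
  rw [← h, ← Nat.card_sigma]
  let f (a : Σ ψ : HomG S U, {x : X.carrier // ∀ u : U, ((φ u, ψ.1 u) : G × G) • x = x} ×
      {y : Y.carrier // ∀ u : U, ((ψ.1 u, χ.1 u) : G × G) • y = y}) :
      {z : X.carrier × Y.carrier //
        ∀ u : U, ((φ u, χ.1 u) : G × G) • FinBiset.tmk z.1 z.2 = FinBiset.tmk z.1 z.2} :=
    ⟨(a.2.1.1, a.2.2.1), fun u => by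
      change _ ∈ MulAction.stabilizer (G × G) _
      rw [FinBiset.stabilizer_tmk]
      exact ⟨a.1.1 u, a.2.1.2 u, a.2.2.2 u⟩⟩
  refine (Nat.card_congr (Equiv.ofBijective f ⟨?_, ?_⟩)).symm
  · rintro ⟨ψ, ⟨x, hx⟩, ⟨y, hy⟩⟩ ⟨ψ', ⟨x', hx'⟩, ⟨y', hy'⟩⟩ hab
    have h1 : x = x' := congrArg (fun z => z.1.1) hab
    have h2 : y = y' := congrArg (fun z => z.1.2) hab
    subst h1 h2
    have h3 : ψ = ψ' := Subtype.ext <| MonoidHom.ext fun u =>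
      eq_of_smul_eq_right hΔ hX (hx u) (hx' u)
    subst h3
    rfl
  · rintro ⟨⟨x, y⟩, hz⟩
    -- The stabilizer of `x ×_G y` is `stab(x) * stab(y)`, so each `u` is linked to `φ u` on one
    -- side and `χ u` on the other by some `h`; right freeness on `X` makes `h` unique and
    -- multiplicative in `u`.
    have hz' (u : U) : ∃ h : G, ((φ u, h) : G × G) • x = x ∧ ((h, χ.1 u) : G × G) • y = y := by
      have h1 : ((φ u, χ.1 u) : G × G) ∈ MulAction.stabilizer (G × G) (FinBiset.tmk x y) := hz u
      rw [FinBiset.stabilizer_tmk] at h1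
      exact h1
    choose ψ h1 h2 using hz'
    let ψ' : U →* G := MonoidHom.mk' ψ fun a b => by
      refine eq_of_smul_eq_right hΔ hX (h1 (a * b)) ?_
      rw [map_mul, ← Prod.mk_mul_mk, mul_smul, h1, h1]
    have hψ' : graph ψ' ∈ S := by
      -- The graph of `ψ'` lies in the composite of `stab(y)` with the graph of `χ`.
      refine hS.subgroup_mem _ (hS.star_mem _ (hY y) _ χ.2) _ ?_
      rintro _ ⟨u, rfl⟩
      exact ⟨χ.1 u, h2 u, ⟨u, rfl⟩⟩
    exact ⟨⟨⟨ψ', hψ'⟩, ⟨x, h1⟩, ⟨y, h2⟩⟩, rfl⟩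

end Bifree

/-! ### The regular biset and transitive bisets -/

section Transitive

variable {G : Type u} [Group G] [Finite G]

theorem fixCount_regular_eq_zero {U : Type*} [Group U] {φ ψ : U →* G}
    (h : ¬ ∃ g : G, ∀ u, φ u = g * ψ u * g⁻¹) :
    fixCount (FinBiset.regular G) (pairGraph φ ψ) = 0 := by
  rw [fixCount_pairGraph]
  have : IsEmpty {x : (FinBiset.regular G).carrier // ∀ u : U, ((φ u, ψ u) : G × G) • x = x} := by
    refine ⟨?_⟩
    rintro ⟨(x : G), hx⟩
    refine h ⟨x, fun u => ?_⟩
    have h1 : φ u * x * (ψ u)⁻¹ = x := hx u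
    rw [eq_mul_inv_iff_mul_eq]
    exact mul_inv_eq_iff_eq_mul.1 h1
  exact Nat.card_of_isEmpty

/-- The fixed points are the `x ∈ G` that conjugate `ψ` into `φ`; they form the coset `C_G(φ(U)) g`.
-/
theorem fixCount_regular {U : Type*} [Group U] {φ ψ : U →* G} {g : G}
    (h : ∀ u, φ u = g * ψ u * g⁻¹) :
    fixCount (FinBiset.regular G) (pairGraph φ ψ) =
      Nat.card (Subgroup.centralizer (φ.range : Set G)) := by
  rw [fixCount_pairGraph]
  refine (Nat.card_congr ((Equiv.mulRight g).subtypeEquiv fun c => ?_)).symm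
  rw [← SetLike.mem_coe, SetLike.mem_coe, Subgroup.mem_centralizer_iff]
  have h1 (u : U) : φ u * (c * g) * (ψ u)⁻¹ = c * g ↔ φ u * c = c * φ u := by
    rw [h u, mul_inv_eq_iff_eq_mul]
    constructor
    · intro h2
      rw [← mul_left_inj g]
      simpa [mul_assoc] using h2
    · intro h2
      have := congrArg (· * g) h2
      simpa [mul_assoc] using this
  constructor
  · exact fun h2 u => (h1 u).2 (h2 _ ⟨u, rfl⟩)
  · rintro h2 _ ⟨u, rfl⟩
    exact (h1 u).1 (h2 u)

/-- The fixed points of `L'` on `(G × G)/L`. -/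
theorem card_mul_fixCount_coset (L L' : Subgroup (G × G)) :
    Nat.card L * fixCount (FinBiset.coset L) L' =
      Nat.card {a : G × G // L' ≤ conjugate a L} := by
  let s : Set ((G × G) ⧸ L) := {x | ∀ g ∈ L', g • x = x}
  -- Each fixed coset is counted through its `|L|` representatives `a`, and `aL` is fixed by `L'`
  -- exactly when `L' ≤ a L a⁻¹`.
  have h1 : fixCount (FinBiset.coset L) L' = Nat.card s := rfl
  rw [h1, ← Nat.card_prod, ← Nat.card_congr (QuotientGroup.preimageMkEquivSubgroupProdSet L s)]
  refine Nat.card_congr (Equiv.subtypeEquivRight fun a => ?_)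
  have h2 (g : G × G) : g • (a : (G × G) ⧸ L) = a ↔ g ∈ conjugate a L := by
    change ((g * a : G × G) : (G × G) ⧸ L) = a ↔ _
    rw [eq_comm, QuotientGroup.eq]
    constructor
    · intro hg
      exact ⟨_, hg, by simp [mul_assoc]⟩
    · rintro ⟨l, hl, rfl⟩
      simpa [mul_assoc] using hl
  exact forall₂_congr fun g _ => h2 g

end Transitive

/-! ### The ghost map -/

section Ghost

variable {G : Type u} [Group G] [Finite G] (R : Type w) [Field R] {S : Set (Subgroup (G × G))}
  (hS : IsStable S)

/-- The `R`-linear extension of the marks to `R B^S(G, G)`. -/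
noncomputable def ghost : BurnsideAlgebra R hS →ₗ[R] (Subgroup (G × G) → R) :=
  let f : burnsideSubring hS →+ (Subgroup (G × G) → R) :=
    { toFun := fun b L => ((markHom L (b : DoubleBurnside G) : ℤ) : R)
      map_zero' := by
        ext L
        simp
      map_add' := fun a b => by
        ext L
        simp }
  TensorProduct.AlgebraTensorModule.lift (LinearMap.toSpanSingleton R _ f.toIntLinearMap)

variable {R hS}

theorem ghost_tmul (r : R) {X : FinBiset G} (hX : FinBiset.StabilizersIn S X)
    (L : Subgroup (G × G)) : ghost R hS (r ⊗ₜ clsS hS X hX) L = r * (fixCount X L : R) := by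
  change r * ((markHom L (cls X) : ℤ) : R) = _
  rw [markHom_cls, Int.cast_natCast]

theorem BurnsideAlgebra.induction {p : BurnsideAlgebra R hS → Prop} (zero : p 0)
    (add : ∀ a b, p a → p b → p (a + b))
    (coset : ∀ (r : R) (L) (hL : L ∈ S),
      p (r ⊗ₜ clsS hS (FinBiset.coset L) (FinBiset.StabilizersIn.coset hS hL)))
    (a : BurnsideAlgebra R hS) : p a := by
  induction a using TensorProduct.induction_on with
  | zero => exact zero
  | add a b ha hb => exact add a b ha hb
  | tmul r b =>
    obtain ⟨b, hb⟩ := b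
    have hb' : b ∈ burnsideSubgroup S := hb
    induction hb' using AddSubgroup.closure_induction generalizing r with
    | mem b h =>
      obtain ⟨L, hL, rfl⟩ := h
      exact coset r L hL
    | zero =>
      have : (⟨0, hb⟩ : burnsideSubring hS) = 0 := rfl
      rw [this, TensorProduct.tmul_zero]
      exact zero
    | add x y hx hy ihx ihy =>
      have : (⟨x + y, hb⟩ : burnsideSubring hS) = ⟨x, hx⟩ + ⟨y, hy⟩ := rfl
      rw [this, TensorProduct.tmul_add]
      exact add _ _ (ihx r hx) (ihy r hy)
    | neg x hx ihx =>
      have : (⟨-x, hb⟩ : burnsideSubring hS) = -⟨x, hx⟩ := rfl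
      rw [this, TensorProduct.tmul_neg, ← TensorProduct.neg_tmul]
      exact ihx (-r) hx

theorem ghost_conjugate (a : BurnsideAlgebra R hS) (g : G × G) (L : Subgroup (G × G)) :
    ghost R hS a (conjugate g L) = ghost R hS a L := by
  induction a using BurnsideAlgebra.induction with
  | zero => simp
  | add a b ha hb => simp [ha, hb]
  | coset r L hL => rw [ghost_tmul, ghost_tmul, fixCount_conjugate]

theorem one_eq_tmul_clsS : (1 : BurnsideAlgebra R hS) =
    1 ⊗ₜ clsS hS (FinBiset.regular G) (FinBiset.StabilizersIn.regular hS) := by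
  rw [Algebra.TensorProduct.one_def]
  exact congrArg (fun x => (1 : R) ⊗ₜ x) (Subtype.ext cls_regular.symm)

theorem tmul_clsS_mul (r s : R) {X Y : FinBiset G} (hX : FinBiset.StabilizersIn S X)
    (hY : FinBiset.StabilizersIn S Y) :
    (r ⊗ₜ clsS hS X hX * s ⊗ₜ clsS hS Y hY : BurnsideAlgebra R hS) =
      (r * s) ⊗ₜ clsS hS (FinBiset.tensor X Y) (hX.tensor hS hY) := by
  rw [Algebra.TensorProduct.tmul_mul_tmul]
  exact congrArg (fun x => (r * s) ⊗ₜ x) (Subtype.ext (cls_mul X Y))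

end Ghost

/-! ### The matrices of the action on the permutation modules -/

section Matrices

variable {G : Type u} [Group G] [Finite G] {R : Type w} [Field R] {S : Set (Subgroup (G × G))}
  {hS : IsStable S} {U : Subgroup G}

noncomputable instance : Fintype (HomG S U) := Fintype.ofFinite _

noncomputable instance : Fintype (HomBar S U) := Fintype.ofFinite _

noncomputable instance : DecidableEq (HomBar S U) := Classical.decEq _

/-- The order of the centralizer of the image of a homomorphism. -/
noncomputable def cardCentralizer {U : Type*} [Group U] (φ : U →* G) : ℕ :=
  Nat.card (Subgroup.centralizer (φ.range : Set G))

theorem cardCentralizer_eq_fixCount {U : Type*} [Group U] (φ : U →* G) :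
    cardCentralizer φ = fixCount (FinBiset.regular G) (pairGraph φ φ) :=
  (fixCount_regular (g := 1) fun u => by simp).symm

omit [Finite G] in
theorem cardCentralizer_ne_zero {U : Type*} [Group U] (φ : U →* G) (hG : (Nat.card G : R) ≠ 0) :
    (cardCentralizer φ : R) ≠ 0 := by
  obtain ⟨k, hk⟩ := Subgroup.card_subgroup_dvd_card (Subgroup.centralizer (φ.range : Set G))
  intro h
  rw [cardCentralizer] at h
  rw [hk, Nat.cast_mul, h, zero_mul] at hG
  exact hG rfl

theorem cardCentralizer_congr {φ ψ : HomG S U} (h : φ ≈ ψ) :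
    cardCentralizer φ.1 = cardCentralizer ψ.1 := by
  obtain ⟨g, hg⟩ := h
  rw [cardCentralizer_eq_fixCount, cardCentralizer_eq_fixCount, conjugate_pairGraph hg hg,
    fixCount_conjugate]

theorem ghost_congr (a : BurnsideAlgebra R hS) {φ ψ φ' ψ' : HomG S U} (h : φ ≈ φ') (k : ψ ≈ ψ') :
    ghost R hS a (pairGraph φ.1 ψ.1) = ghost R hS a (pairGraph φ'.1 ψ'.1) := by
  obtain ⟨g, hg⟩ := h
  obtain ⟨k, hk⟩ := k
  rw [conjugate_pairGraph hg hk, ghost_conjugate]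

/-- The class of a homomorphism modulo inner automorphisms of `G`. -/
def HomBar.mk (φ : HomG S U) : HomBar S U := Quotient.mk (homSetoid S U) φ

omit [Finite G] in
theorem HomBar.mk_out (c : HomBar S U) : HomBar.mk (Quotient.out c) = c := Quotient.out_eq c

omit [Finite G] in
theorem HomBar.out_equiv (φ : HomG S U) : Quotient.out (HomBar.mk φ) ≈ φ :=
  Quotient.mk_out φ

omit [Finite G] in
theorem HomBar.mk_eq {φ ψ : HomG S U} : HomBar.mk φ = HomBar.mk ψ ↔ φ ≈ ψ := Quotient.eq

/-- The homomorphism `u ↦ g φ(u) g⁻¹`. -/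
def HomG.conj (hS : IsStable S) (g : G) (φ : HomG S U) : HomG S U :=
  ⟨(MulAut.conj g).toMonoidHom.comp φ.1, by
    refine hS.subgroup_mem _ (hS.conj_mem _ φ.2 (g, 1)) _ ?_
    rintro _ ⟨u, rfl⟩
    exact ⟨(φ.1 u, u), ⟨u, rfl⟩, by simp⟩⟩

/-- Orbit–stabilizer in disguise: each `g ∈ G` is a fixed point for exactly one `φ`, namely `u ↦ g
ψ(u) g⁻¹`. -/
theorem sum_fixCount_regular (hS : IsStable S) (ψ : HomG S U) :
    ∑ φ : HomG S U, fixCount (FinBiset.regular G) (pairGraph φ.1 ψ.1) = Nat.card G := by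
  simp only [fixCount_pairGraph]
  rw [← Nat.card_sigma]
  have h (x g h : G) : g * x * h⁻¹ = x ↔ g = x * h * x⁻¹ := by
    rw [mul_inv_eq_iff_eq_mul, eq_mul_inv_iff_mul_eq]
  refine Nat.card_congr (Equiv.ofBijective (fun a => (show G from a.2.1)) ⟨?_, fun g => ?_⟩)
  · rintro ⟨φ, (x : G), hx⟩ ⟨φ', (x' : G), hx'⟩ hxx
    obtain rfl : x = x' := hxx
    have hφ : φ = φ' := Subtype.ext <| MonoidHom.ext fun u =>
      ((h x _ _).1 (hx u)).trans ((h x _ _).1 (hx' u)).symm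
    subst hφ
    rfl
  · exact ⟨⟨ψ.conj hS g, (show G from g), fun u => (h g _ _).2 rfl⟩, rfl⟩

/-- Orbit counting for the conjugation action of `G` on `Hom_{S_G}(U, G)`. -/
theorem sum_homG (hS : IsStable S) (hG : (Nat.card G : R) ≠ 0) (f : HomG S U → R)
    (hf : ∀ φ ψ, φ ≈ ψ → f φ = f ψ) :
    ∑ φ, f φ = ∑ c : HomBar S U,
      (Nat.card G : R) * (cardCentralizer (Quotient.out c).1 : R)⁻¹ * f (Quotient.out c) := by
  rw [← Finset.sum_fiberwise (g := HomBar.mk)]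
  refine Finset.sum_congr rfl fun c _ => ?_
  have h1 (φ : HomG S U) (hφ : φ ∈ Finset.univ.filter fun φ => HomBar.mk φ = c) :
      f φ = f (Quotient.out c) := by
    rw [Finset.mem_filter] at hφ
    rw [← hφ.2]
    exact hf _ _ (Setoid.symm (HomBar.out_equiv φ))
  rw [Finset.sum_congr rfl h1, Finset.sum_const, nsmul_eq_mul]
  congr 1
  rw [eq_mul_inv_iff_mul_eq₀ (cardCentralizer_ne_zero _ hG), ← Nat.cast_mul]
  congr 1
  -- Each member of the class `c` contributes the order of the centralizer and all other
  -- homomorphisms contribute zero; as the total is `|G|`, the class has `|G| / |C_G|` members.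
  have h2 (φ : HomG S U) : fixCount (FinBiset.regular G) (pairGraph φ.1 (Quotient.out c).1) =
      if HomBar.mk φ = c then cardCentralizer (Quotient.out c).1 else 0 := by
    split_ifs with h
    · rw [← HomBar.mk_out c, HomBar.mk_eq] at h
      obtain ⟨g, hg⟩ := Setoid.symm h
      rw [fixCount_regular hg]
      exact cardCentralizer_congr h
    · refine fixCount_regular_eq_zero fun h' => h ?_
      rw [← HomBar.mk_out c, HomBar.mk_eq]
      exact Setoid.symm (show Quotient.out c ≈ φ from h')
  rw [← sum_fixCount_regular hS (Quotient.out c), Finset.sum_congr rfl fun φ _ => h2 φ,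
    ← Finset.sum_filter, Finset.sum_const, smul_eq_mul]

variable (R hS U) in
/-- The matrix of the action of an element of `R B^S(G, G)` on the permutation module. -/
noncomputable def sigmaMatrix :
    BurnsideAlgebra R hS →ₗ[R] Matrix (HomBar S U) (HomBar S U) R where
  toFun a := Matrix.of fun c d => (cardCentralizer (Quotient.out c).1 : R)⁻¹ * ghost R hS a (pairGraph (Quotient.out c).1 (Quotient.out d).1)
  map_add' a b := by
    ext c d
    simp [mul_add]
  map_smul' r a := by
    ext c d
    simp [mul_left_comm]

theorem sigmaMatrix_apply (a : BurnsideAlgebra R hS) (c d : HomBar S U) :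
    sigmaMatrix R hS U a c d =
      (cardCentralizer (Quotient.out c).1 : R)⁻¹ * ghost R hS a (pairGraph (Quotient.out c).1 (Quotient.out d).1) := rfl

theorem sigmaMatrix_mk (a : BurnsideAlgebra R hS) (φ ψ : HomG S U) :
    sigmaMatrix R hS U a (HomBar.mk φ) (HomBar.mk ψ) =
      (cardCentralizer φ.1 : R)⁻¹ * ghost R hS a (pairGraph φ.1 ψ.1) := by
  rw [sigmaMatrix_apply, cardCentralizer_congr (HomBar.out_equiv φ),
    ghost_congr a (HomBar.out_equiv φ) (HomBar.out_equiv ψ)]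

theorem sigmaMatrix_one (hG : (Nat.card G : R) ≠ 0) :
    sigmaMatrix R hS U 1 = 1 := by
  ext c d
  rw [sigmaMatrix_apply, one_eq_tmul_clsS, ghost_tmul, one_mul]
  by_cases h : c = d
  · subst h
    rw [Matrix.one_apply_eq, ← cardCentralizer_eq_fixCount,
      inv_mul_cancel₀ (cardCentralizer_ne_zero _ hG)]
  · rw [Matrix.one_apply_ne h, fixCount_regular_eq_zero, Nat.cast_zero, mul_zero]
    intro h'
    have h'' : (Quotient.out d) ≈ (Quotient.out c) := h'
    exact h (Quotient.out_equiv_out.1 h'').symm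

/-- By bilinearity two transitive bisets suffice. In the count of fixed points of `X ×_G Y`,
grouping the middle homomorphisms into classes yields the weights `|G| / |C_G(ψ(U))|`. The factor
`|G|` cancels against the left side, and `|C_G(ψ(U))|⁻¹` is precisely the row normalization of the
second matrix. -/
theorem sigmaMatrix_mul (hΔ : ∀ L ∈ S, IsTwistedDiagonal L) (hG : (Nat.card G : R) ≠ 0)
    (a b : BurnsideAlgebra R hS) :
    sigmaMatrix R hS U (a * b) = sigmaMatrix R hS U a * sigmaMatrix R hS U b := by
  induction a using BurnsideAlgebra.induction with
  | zero => simp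
  | add a a' h h' => rw [add_mul, map_add, map_add, h, h', add_mul]
  | coset r L hL =>
    induction b using BurnsideAlgebra.induction with
    | zero => simp
    | add a a' h h' => rw [mul_add, map_add, map_add, h, h', mul_add]
    | coset s M hM =>
      have hX := FinBiset.StabilizersIn.coset hS hL
      have hY := FinBiset.StabilizersIn.coset hS hM
      ext c d
      rw [tmul_clsS_mul, sigmaMatrix_apply, ghost_tmul, Matrix.mul_apply]
      simp only [sigmaMatrix_apply, ghost_tmul]
      have h1 := congrArg (Nat.cast (R := R))
        (card_mul_fixCount_tensor hΔ hX hY hS (Quotient.out c).1 (Quotient.out d))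
      push_cast at h1
      rw [sum_homG hS hG] at h1
      · simp only [mul_assoc, ← Finset.mul_sum] at h1
        rw [mul_right_inj' hG] at h1
        rw [h1, Finset.mul_sum, Finset.mul_sum]
        refine Finset.sum_congr rfl fun e _ => ?_
        ring
      · rintro φ ψ ⟨g, hg⟩
        rw [conjugate_pairGraph (g := 1) (φ := (Quotient.out c).1) (φ' := (Quotient.out c).1) (by simp) hg,
          conjugate_pairGraph (h := 1) (ψ := (Quotient.out d).1) (ψ' := (Quotient.out d).1) hg (by simp),
          fixCount_conjugate, fixCount_conjugate]

omit [Finite G] in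
-- The division of natural numbers in `mark` is exact because the centralizer acts freely on the
-- fixed points, so it survives the passage to `R`.
theorem cast_mark (hΔ : ∀ L ∈ S, IsTwistedDiagonal L) (hG : (Nat.card G : R) ≠ 0)
    {X : FinBiset G} (hX : FinBiset.StabilizersIn S X) (φ ψ : U →* G) :
    (mark X φ ψ : R) = (cardCentralizer φ : R)⁻¹ * (fixCount X (pairGraph φ ψ) : R) := by
  rw [mark, ← fixCount_pairGraph, Nat.cast_div (card_centralizer_dvd_fixCount hΔ hX φ ψ)
    (cardCentralizer_ne_zero φ hG), div_eq_inv_mul]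
  rfl

theorem sigmaMatrix_tmul (hΔ : ∀ L ∈ S, IsTwistedDiagonal L) (hG : (Nat.card G : R) ≠ 0)
    (r : R) {X : FinBiset G} (hX : FinBiset.StabilizersIn S X) (c d : HomBar S U) :
    sigmaMatrix R hS U (r ⊗ₜ clsS hS X hX) c d = r * (mark X (Quotient.out c).1 (Quotient.out d).1 : R) := by
  rw [sigmaMatrix_apply, ghost_tmul, cast_mark hΔ hG hX]
  ring

/-- The matrices of the action are invariant under `Out_{S_G}(U)`. -/
theorem sigmaMatrix_smul (a : BurnsideAlgebra R hS) (g : (OutS hS U)ᵐᵒᵖ) (c d : HomBar S U) :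
    sigmaMatrix R hS U a (g • c) (g • d) = sigmaMatrix R hS U a c d := by
  induction c using Quotient.inductionOn with
  | h φ =>
    induction d using Quotient.inductionOn with
    | h ψ =>
      induction g using MulOpposite.rec' with
      | h g =>
        induction g using QuotientGroup.induction_on with
        | H α =>
          change sigmaMatrix R hS U a (HomBar.mk (φ.precomp hS α))
            (HomBar.mk (ψ.precomp hS α)) = sigmaMatrix R hS U a (HomBar.mk φ) (HomBar.mk ψ)
          have hα : Function.Surjective α.1.toMonoidHom := α.1.surjective
          rw [sigmaMatrix_mk, sigmaMatrix_mk]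
          -- Precomposing both maps with an automorphism of `U` only reparametrizes the subgroup of
          -- pairs. The centralizer order is a mark of the regular biset, so it is invariant for the
          -- same reason.
          have h1 := pairGraph_comp φ.1 ψ.1 hα
          have h2 := pairGraph_comp φ.1 φ.1 hα
          rw [cardCentralizer_eq_fixCount, cardCentralizer_eq_fixCount]
          change (fixCount _ (pairGraph (φ.1.comp _) (φ.1.comp _)) : R)⁻¹ *
            ghost R hS a (pairGraph (φ.1.comp _) (ψ.1.comp _)) = _
          rw [h1, h2]

end Matrices

/-! ### The action on the permutation modules -/

section PermModules

variable {G : Type u} [Group G] [Finite G] {R : Type w} [Field R] {S : Set (Subgroup (G × G))}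
  {hS : IsStable S} {U : Subgroup G}

variable (R hS U) in
/-- The basis of the permutation module. -/
noncomputable def permBasis : Module.Basis (HomBar S U) R (PermModule R hS U) :=
  .ofRepr ((Representation.ofMulAction R (OutS hS U)ᵐᵒᵖ (HomBar S U)).asModuleEquiv.trans
      (MonoidAlgebra.coeffLinearEquiv R))

theorem of_smul_permBasis (g : (OutS hS U)ᵐᵒᵖ) (c : HomBar S U) :
    MonoidAlgebra.of R _ g • permBasis R hS U c = permBasis R hS U (g • c) := by
  have h (c : HomBar S U) : permBasis R hS U c =
    (Representation.ofMulAction R (OutS hS U)ᵐᵒᵖ (HomBar S U)).asModuleEquiv.symm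
      (MonoidAlgebra.single c 1) := rfl
  rw [h, h, ← Representation.asModuleEquiv_symm_map_rho, Representation.ofMulAction_single]

theorem permBasis_repr_smul (g : (OutS hS U)ᵐᵒᵖ) (x : PermModule R hS U) (c : HomBar S U) :
    (permBasis R hS U).repr ((MonoidAlgebra.of R _ g : OutAlgebra R hS U) • x) (g • c) =
      (permBasis R hS U).repr x c := by
  have h : Finsupp.lapply (g • c) ∘ₗ (permBasis R hS U).repr.toLinearMap ∘ₗ
      Algebra.lsmul R R _ (MonoidAlgebra.of R _ g : OutAlgebra R hS U) =
      Finsupp.lapply c ∘ₗ (permBasis R hS U).repr.toLinearMap := by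
    refine (permBasis R hS U).ext fun d => ?_
    change (permBasis R hS U).repr (MonoidAlgebra.of R _ g • permBasis R hS U d) (g • c) =
      (permBasis R hS U).repr (permBasis R hS U d) c
    rw [of_smul_permBasis, Module.Basis.repr_self, Module.Basis.repr_self]
    classical
    simp [Finsupp.single_apply]
  exact DFunLike.congr_fun h x

theorem sigma_permBasis (X : FinBiset G) (d : HomBar S U) :
    sigma R hS U X (permBasis R hS U d) =
      ∑ c, (mark X (Quotient.out c).1 (Quotient.out d).1 : R) • permBasis R hS U c := by
  apply (permBasis R hS U).repr.injective
  have h (x) : (permBasis R hS U).repr (sigma R hS U X x) =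
      Finsupp.linearCombination R (fun ψ : HomBar S U =>
        Finsupp.equivFunOnFinite.symm fun φ : HomBar S U =>
          (mark X (Quotient.out φ).1 (Quotient.out ψ).1 : R)) ((permBasis R hS U).repr x) :=
    (permBasis R hS U).repr.apply_symm_apply _
  rw [h, Module.Basis.repr_self, Finsupp.linearCombination_single, one_smul]
  ext c
  simp [Finsupp.single_apply]

/-- An `R`-linear map is linear over the group algebra if it commutes with the group. -/
theorem map_outAlgebra_smul (f : PermModule R hS U →ₗ[R] PermModule R hS U)
    (hf : ∀ (g : (OutS hS U)ᵐᵒᵖ) c, f (permBasis R hS U (g • c)) =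
      MonoidAlgebra.of R _ g • f (permBasis R hS U c)) (a : OutAlgebra R hS U)
    (x : PermModule R hS U) : f (a • x) = a • f x := by
  induction a using MonoidAlgebra.induction_on with
  | of g =>
    have h : f ∘ₗ Algebra.lsmul R R _ (MonoidAlgebra.of R _ g : OutAlgebra R hS U) =
        Algebra.lsmul R R _ (MonoidAlgebra.of R _ g : OutAlgebra R hS U) ∘ₗ f := by
      refine (permBasis R hS U).ext fun c => ?_
      change f (MonoidAlgebra.of R _ g • _) = MonoidAlgebra.of R _ g • f _
      rw [of_smul_permBasis, hf]
    exact DFunLike.congr_fun h x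
  | add a b ha hb => rw [add_smul, map_add, ha, hb, add_smul]
  | smul r a ha => rw [smul_assoc, map_smul, ha, smul_assoc]

/-- The `R Out_{S_G}(U)`-endomorphism of the permutation module given by an invariant matrix. -/
noncomputable def endOfMatrix (M : Matrix (HomBar S U) (HomBar S U) R)
    (hM : ∀ (g : (OutS hS U)ᵐᵒᵖ) c d, M (g • c) (g • d) = M c d) :
    Module.End (OutAlgebra R hS U) (PermModule R hS U) where
  toFun := Matrix.toLin (permBasis R hS U) (permBasis R hS U) M
  map_add' := map_add _
  map_smul' := map_outAlgebra_smul _ fun g d => by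
    rw [Matrix.toLin_self, Matrix.toLin_self, Finset.smul_sum,
      ← Equiv.sum_comp (MulAction.toPerm g)]
    refine Finset.sum_congr rfl fun c _ => ?_
    rw [MulAction.toPerm_apply, hM, ← of_smul_permBasis, smul_comm]

theorem endOfMatrix_apply (M : Matrix (HomBar S U) (HomBar S U) R) (hM) (x : PermModule R hS U) :
    endOfMatrix M hM x = Matrix.toLin (permBasis R hS U) (permBasis R hS U) M x := rfl

/-- Every `R Out_{S_G}(U)`-endomorphism is given by an invariant matrix. -/
theorem exists_endOfMatrix_eq (f : Module.End (OutAlgebra R hS U) (PermModule R hS U)) :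
    ∃ M hM, endOfMatrix M hM = f := by
  let f' : PermModule R hS U →ₗ[R] PermModule R hS U :=
    { toFun := f
      map_add' := map_add f
      map_smul' := fun r x => by
        rw [← algebraMap_smul (OutAlgebra R hS U) r x, map_smul, algebraMap_smul]
        rfl }
  refine ⟨LinearMap.toMatrix (permBasis R hS U) (permBasis R hS U) f', fun g c d => ?_, ?_⟩
  · rw [LinearMap.toMatrix_apply, LinearMap.toMatrix_apply, ← of_smul_permBasis]
    have h1 : f' (MonoidAlgebra.of R _ g • permBasis R hS U d) =
      MonoidAlgebra.of R _ g • f' (permBasis R hS U d) := map_smul f _ _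
    rw [h1, permBasis_repr_smul]
  · ext x
    rw [endOfMatrix_apply, Matrix.toLin_toMatrix]
    rfl

theorem permModule_finite : Module.Finite (OutAlgebra R hS U) (PermModule R hS U) :=
  have : Module.Finite R (PermModule R hS U) := .of_basis (permBasis R hS U)
  Module.Finite.of_restrictScalars_finite R _ _

/-- Maschke's theorem; this is where the order of `Out(U)` must be invertible. -/
theorem permModule_isSemisimple (h : (Nat.card (OutS hS U) : R) ≠ 0) :
    IsSemisimpleModule (OutAlgebra R hS U) (PermModule R hS U) := by
  have : NeZero (Nat.card (OutS hS U)ᵐᵒᵖ : R) := ⟨by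
    rwa [Nat.card_congr MulOpposite.opEquiv.symm]⟩
  have : Finite (OutS hS U)ᵐᵒᵖ := Finite.of_equiv _ MulOpposite.opEquiv
  infer_instance

end PermModules

/-! ### The ghost map is bijective onto the class functions on `S` -/

section GhostBijective

theorem eq_conjugate_iff {G : Type*} [Group G] (a : G) {L L' : Subgroup G} :
    L' = conjugate a L ↔ L = conjugate a⁻¹ L' := by
  constructor
  · rintro rfl
    rw [← conjugate_mul, inv_mul_cancel, conjugate_one]
  · rintro rfl
    rw [← conjugate_mul, mul_inv_cancel, conjugate_one]

variable {G : Type u} [Group G] [Finite G] {R : Type w} [Field R] {S : Set (Subgroup (G × G))}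
  {hS : IsStable S}

/-- The map is `aL ↦ a g⁻¹ (g L g⁻¹)`. It allows one transitive biset per conjugacy class to span
the algebra. -/
theorem iso_coset_conjugate (g : G × G) (L : Subgroup (G × G)) :
    FinBiset.Iso (FinBiset.coset L) (FinBiset.coset (conjugate g L)) := by
  have h (a b : G × G) : (a * g⁻¹)⁻¹ * (b * g⁻¹) ∈ conjugate g L ↔ a⁻¹ * b ∈ L := by
    have h1 : (a * g⁻¹)⁻¹ * (b * g⁻¹) = (MulAut.conj g).toMonoidHom (a⁻¹ * b) := by
      simp [mul_assoc]
    rw [h1]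
    exact Subgroup.mem_map_iff_mem (MulAut.conj g).injective
  let f : (G × G) ⧸ L → (G × G) ⧸ conjugate g L :=
    Quotient.map' (fun a => a * g⁻¹) fun a b hab =>
      QuotientGroup.leftRel_apply.2 ((h a b).2 (QuotientGroup.leftRel_apply.1 hab))
  refine ⟨Equiv.ofBijective f ⟨?_, ?_⟩, ?_⟩
  · rintro ⟨a⟩ ⟨b⟩ hab
    exact QuotientGroup.eq.2 ((h a b).1 (QuotientGroup.eq.1 hab))
  · rintro ⟨a⟩
    exact ⟨QuotientGroup.mk (a * g), congrArg QuotientGroup.mk (mul_inv_cancel_right a g)⟩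
  · rintro b ⟨a⟩
    exact congrArg QuotientGroup.mk (mul_assoc b a g⁻¹)

theorem le_conjugate_iff (a : G) {L L' : Subgroup G} (h : Nat.card L ≤ Nat.card L') :
    L' ≤ conjugate a L ↔ L' = conjugate a L :=
  ⟨fun h' => Subgroup.eq_of_le_of_card_ge h' (by rwa [card_conjugate]), fun h' => h'.le⟩

/-- A combination of transitive bisets with stabilizers of order `n`. -/
noncomputable def layer (hS : IsStable S) (m : Subgroup (G × G) → R) (n : ℕ) :
    BurnsideAlgebra R hS :=
  let _ : Fintype {L : Subgroup (G × G) // L ∈ S ∧ Nat.card L = n} := Fintype.ofFinite _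
  ∑ L : {L : Subgroup (G × G) // L ∈ S ∧ Nat.card L = n},
    -- The sum runs over all subgroups of order `n`, not over classes. The factor `|L|` turns fixed
    -- cosets into elements `a` with `L' ≤ a L a⁻¹`, and `|G × G|⁻¹` averages over these `a`.
    ((Nat.card (G × G) : R)⁻¹ * m L.1 * Nat.card L.1) ⊗ₜ
      clsS hS (FinBiset.coset L.1) (FinBiset.StabilizersIn.coset hS L.2.1)

theorem ghost_layer (m : Subgroup (G × G) → R) (n : ℕ) (L' : Subgroup (G × G))
    [Fintype {L : Subgroup (G × G) // L ∈ S ∧ Nat.card L = n}] :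
    ghost R hS (layer hS m n) L' = ∑ L : {L : Subgroup (G × G) // L ∈ S ∧ Nat.card L = n},
      (Nat.card (G × G) : R)⁻¹ * m L.1 * Nat.card {a : G × G // L' ≤ conjugate a L.1} := by
  rw [layer, map_sum, Finset.sum_apply]
  refine Finset.sum_congr (by ext; simp) fun L _ => ?_
  rw [ghost_tmul, mul_assoc, ← Nat.cast_mul, card_mul_fixCount_coset]

/-- Triangularity: a subgroup of larger order lies in no conjugate of a stabilizer of order `n`. -/
theorem ghost_layer_of_lt (m : Subgroup (G × G) → R) {n : ℕ} {L' : Subgroup (G × G)}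
    (h : n < Nat.card L') : ghost R hS (layer hS m n) L' = 0 := by
  have : Fintype {L : Subgroup (G × G) // L ∈ S ∧ Nat.card L = n} := Fintype.ofFinite _
  rw [ghost_layer]
  refine Finset.sum_eq_zero fun L _ => ?_
  have : IsEmpty {a : G × G // L' ≤ conjugate a L.1} := by
    refine ⟨fun a => ?_⟩
    have h1 := Subgroup.card_le_of_le a.2
    rw [card_conjugate, L.2.2] at h1
    exact absurd h1 (not_le.2 h)
  rw [Nat.card_of_isEmpty (α := {a : G × G // L' ≤ conjugate a L.1}), Nat.cast_zero, mul_zero]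

/-- At equal orders, containment in a conjugate is equality, so each `a ∈ G × G` selects the single
subgroup `L = a⁻¹ L' a`, where `m` has the value `m L'`. The sum is the average of this constant. -/
theorem ghost_layer_of_eq (hG : (Nat.card G : R) ≠ 0) {m : Subgroup (G × G) → R}
    (hm : ∀ L ∈ S, ∀ g, m (conjugate g L) = m L) {n : ℕ} {L' : Subgroup (G × G)} (hL' : L' ∈ S)
    (h : Nat.card L' = n) : ghost R hS (layer hS m n) L' = m L' := by
  classical
  have : Fintype {L : Subgroup (G × G) // L ∈ S ∧ Nat.card L = n} := Fintype.ofFinite _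
  have : Fintype (G × G) := Fintype.ofFinite _
  have hGG : (Nat.card (G × G) : R) ≠ 0 := by
    rw [Nat.card_prod, Nat.cast_mul]
    exact mul_ne_zero hG hG
  rw [ghost_layer]
  have h1 (L : {L : Subgroup (G × G) // L ∈ S ∧ Nat.card L = n}) :
      (Nat.card (G × G) : R)⁻¹ * m L.1 * Nat.card {a : G × G // L' ≤ conjugate a L.1} =
        ∑ a : G × G, if L = ⟨conjugate a⁻¹ L', hS.conj_mem _ hL' _, (card_conjugate _ _).trans h⟩
          then (Nat.card (G × G) : R)⁻¹ * m L' else 0 := by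
    rw [Nat.card_eq_fintype_card (α := {a : G × G // L' ≤ conjugate a L.1}), Fintype.card_subtype, Finset.card_filter, Nat.cast_sum,
      Finset.mul_sum]
    refine Finset.sum_congr rfl fun a _ => ?_
    have h3 : L' ≤ conjugate a L.1 ↔
        L = ⟨conjugate a⁻¹ L', hS.conj_mem _ hL' _, (card_conjugate _ _).trans h⟩ := by
      rw [le_conjugate_iff a (by rw [L.2.2, h]), eq_conjugate_iff, Subtype.ext_iff]
    simp only [h3]
    split_ifs with h2
    · rw [h2, hm _ hL', Nat.cast_one, mul_one]
    · rw [Nat.cast_zero, mul_zero]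
  rw [Finset.sum_congr rfl fun L _ => h1 L, Finset.sum_comm]
  simp only [Finset.sum_ite_eq', Finset.mem_univ, if_true, Finset.sum_const, Finset.card_univ]
  rw [nsmul_eq_mul, ← Nat.card_eq_fintype_card, mul_inv_cancel_left₀ hGG]

/-- Triangular elimination from the largest orders down: the layer of order `n` matches `m` there
and leaves larger orders untouched, so subtracting it lowers the bound on the support of `m`. -/
theorem exists_ghost_eq (hS : IsStable S) (hG : (Nat.card G : R) ≠ 0) (m : Subgroup (G × G) → R)
    (hm : ∀ L ∈ S, ∀ g, m (conjugate g L) = m L) :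
    ∃ a : BurnsideAlgebra R hS, ∀ L ∈ S, ghost R hS a L = m L := by
  suffices h : ∀ (n : ℕ) (m : Subgroup (G × G) → R), (∀ L ∈ S, ∀ g, m (conjugate g L) = m L) →
      (∀ L ∈ S, n ≤ Nat.card L → m L = 0) →
      ∃ a : BurnsideAlgebra R hS, ∀ L ∈ S, ghost R hS a L = m L by
    -- The initial bound exceeds every subgroup order, so the vanishing condition is vacuous.
    refine h (Nat.card (G × G) + 1) m hm fun L _ hL => ?_
    exact absurd (Subgroup.card_le_card_group L) (by omega)
  intro n
  induction n with
  | zero => exact fun m _ h => ⟨0, fun L hL => by simp [h L hL]⟩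
  | succ n ih =>
    intro m hm h
    obtain ⟨a, ha⟩ := ih (m - ghost R hS (layer hS m n))
      (fun L hL g => by rw [Pi.sub_apply, Pi.sub_apply, hm L hL, ghost_conjugate])
      (fun L hL hn => by
        rw [Pi.sub_apply]
        rcases hn.eq_or_lt with hn | hn
        · rw [ghost_layer_of_eq hG hm hL hn.symm, sub_self]
        · rw [ghost_layer_of_lt m hn, h L hL hn, sub_zero])
    refine ⟨a + layer hS m n, fun L hL => ?_⟩
    rw [map_add, Pi.add_apply, ha L hL, Pi.sub_apply, sub_add_cancel]

/-- A dimension count. One transitive biset per conjugacy class in `S` spans the algebra (`p`), and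
the marks at the same classes are surjective (`q`). So `q ∘ p` is a surjective endomorphism of a
finite-dimensional space, hence injective. -/
theorem eq_zero_of_ghost_eq_zero (hG : (Nat.card G : R) ≠ 0) {a : BurnsideAlgebra R hS}
    (ha : ∀ L ∈ S, ghost R hS a L = 0) : a = 0 := by
  let s : Setoid S :=
    { r := fun L M => ∃ g, M.1 = conjugate g L.1
      iseqv :=
        { refl := fun L => ⟨1, (conjugate_one _).symm⟩
          symm := fun ⟨g, hg⟩ => ⟨g⁻¹, (eq_conjugate_iff g).1 hg⟩
          trans := fun ⟨g, hg⟩ ⟨h, hh⟩ => ⟨h * g, by rw [hh, hg, conjugate_mul]⟩ } }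
  let Q := Quotient s
  have : Fintype Q := Fintype.ofFinite _
  let v (q : Q) : BurnsideAlgebra R hS :=
    1 ⊗ₜ clsS hS (FinBiset.coset q.out.1) (FinBiset.StabilizersIn.coset hS q.out.2)
  let p : (Q → R) →ₗ[R] BurnsideAlgebra R hS := Fintype.linearCombination R v
  have hp : Function.Surjective p := by
    rw [← LinearMap.range_eq_top, eq_top_iff]
    rintro b -
    induction b using BurnsideAlgebra.induction with
    | zero => exact zero_mem _
    | add a b ha hb => exact add_mem ha hb
    | coset r L hL =>
      obtain ⟨g, hg⟩ : s.r (Quotient.out (Quotient.mk s ⟨L, hL⟩)) ⟨L, hL⟩ :=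
        Quotient.mk_out (s := s) ⟨L, hL⟩
      have h1 : clsS hS (FinBiset.coset L) (FinBiset.StabilizersIn.coset hS hL) =
          clsS hS (FinBiset.coset (Quotient.out (Quotient.mk s ⟨L, hL⟩)).1)
            (FinBiset.StabilizersIn.coset hS (Quotient.out (Quotient.mk s ⟨L, hL⟩)).2) := by
        refine Subtype.ext (cls_eq_of_iso ?_)
        have h2 := iso_coset_conjugate g (Quotient.out (Quotient.mk s ⟨L, hL⟩)).1
        rw [← hg] at h2
        exact (FinBiset.isoSetoid G).symm h2
      classical
      refine ⟨Pi.single (Quotient.mk s ⟨L, hL⟩) r, ?_⟩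
      rw [h1, Fintype.linearCombination_apply_single, TensorProduct.smul_tmul', smul_eq_mul,
        mul_one]
  let q : BurnsideAlgebra R hS →ₗ[R] (Q → R) :=
    LinearMap.pi fun c => LinearMap.proj c.out.1 ∘ₗ ghost R hS
  have hq : Function.Surjective q := by
    classical
    intro f
    have hext (L : Subgroup (G × G)) (hL : L ∈ S) (g : G × G) :
        (Quotient.mk s ⟨conjugate g L, hS.conj_mem L hL g⟩ : Q) = Quotient.mk s ⟨L, hL⟩ :=
      (Quotient.sound (s := s) ⟨g, rfl⟩).symm
    obtain ⟨b, hb⟩ := exists_ghost_eq hS hG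
      (fun L => if h : L ∈ S then f (Quotient.mk s ⟨L, h⟩) else 0) (fun L hL g => by
        rw [dif_pos hL, dif_pos (hS.conj_mem L hL g), hext])
    refine ⟨b, funext fun c => ?_⟩
    change ghost R hS b c.out.1 = _
    rw [hb _ c.out.2, dif_pos c.out.2]
    exact congrArg f (Quotient.out_eq c)
  have hpq : Function.Injective (q ∘ₗ p) :=
    LinearMap.injective_iff_surjective.2 (hq.comp hp)
  obtain ⟨c, rfl⟩ := hp a
  have h0 : (q ∘ₗ p) c = 0 := funext fun x => ha _ x.out.2
  rw [(map_eq_zero_iff _ hpq).1 h0, map_zero]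

end GhostBijective

/-! ### Twisted diagonal subgroups and pairs of homomorphisms -/

section Pairs

variable {G : Type u} [Group G] {S : Set (Subgroup (G × G))}

theorem HomG.injective (hΔ : ∀ L ∈ S, IsTwistedDiagonal L) {U : Subgroup G} (φ : HomG S U) :
    Function.Injective φ.1 := by
  rw [injective_iff_map_eq_one]
  intro u hu
  have h : ((1, (u : G)) : G × G) ∈ graph φ.1 := ⟨u, Prod.ext hu rfl⟩
  exact Subtype.ext ((hΔ _ φ.2).eq_one_right h)

variable (hS : IsStable S) (hII : ∀ L ∈ S, opposite L ∈ S)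
include hS hII

/-- The subgroup of pairs lies in the composite of the graph of `φ` with the opposite of the graph
of `ψ`. -/
theorem pairGraph_mem {U : Subgroup G} (φ ψ : HomG S U) : pairGraph φ.1 ψ.1 ∈ S := by
  refine hS.subgroup_mem _ (hS.star_mem _ φ.2 _ (hII _ ψ.2)) _ ?_
  rintro _ ⟨u, rfl⟩
  exact ⟨u, ⟨u, rfl⟩, ⟨u, rfl⟩⟩

omit hII in
-- A twisted diagonal subgroup is the pair of `α` and the inclusion of `V`; precomposing with an
-- isomorphism from the representative of `V` in `T` does not change it.
theorem exists_pairGraph_eq (hΔ : ∀ L ∈ S, IsTwistedDiagonal L) {T : Set (Subgroup G)}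
    (hT : IsTransversal S T) {L : Subgroup (G × G)} (hL : L ∈ S) :
    ∃ (U : T) (φ ψ : HomG S U.1), L = pairGraph φ.1 ψ.1 := by
  obtain ⟨U₀, V, α, rfl⟩ := hΔ L hL
  obtain ⟨U, ⟨hU, e, he, he'⟩, -⟩ := hT V
  exact ⟨⟨U, hU⟩, ⟨(U₀.subtype.comp α.toMonoidHom).comp e.symm.toMonoidHom, graph_comp hS hL he'⟩,
    ⟨V.subtype.comp e.symm.toMonoidHom, he'⟩,
    (pairGraph_comp (α := e.symm.toMonoidHom) _ _ e.symm.surjective).symm⟩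

/-- Since `ψ` is injective on the twisted diagonal subgroups at issue, `α` is in effect `ψ⁻¹ ∘ φ`;
its graph lies in the composite of the opposite of the graph of `ψ` with the graph of `φ`. -/
theorem mem_homSet_of_comp_eq {U V : Subgroup G}
    {φ : HomG S U} {ψ : HomG S V} {α : U →* V} (h : ∀ u, φ.1 u = ψ.1 (α u)) :
    α ∈ homSet S U V := by
  refine hS.subgroup_mem _ (hS.star_mem _ (hII _ ψ.2) _ φ.2) _ ?_
  rintro _ ⟨u, rfl⟩
  exact ⟨φ.1 u, ⟨α u, Prod.ext (h u).symm rfl⟩, ⟨u, rfl⟩⟩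

/-- The maps are injective, so both `U` and `V` parametrize the common subgroup bijectively; `α`
compares the two parametrizations. -/
theorem exists_iso_of_pairGraph_eq (hΔ : ∀ L ∈ S, IsTwistedDiagonal L) {U V : Subgroup G}
    {φ ψ : HomG S U} {φ' ψ' : HomG S V} (h : pairGraph φ.1 ψ.1 = pairGraph φ'.1 ψ'.1) :
    ∃ α : U ≃* V, α.toMonoidHom ∈ homSet S U V ∧ α.symm.toMonoidHom ∈ homSet S V U ∧
      (∀ u, φ.1 u = φ'.1 (α u)) ∧ ∀ u, ψ.1 u = ψ'.1 (α u) := by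
  have h1 (u : U) : ∃ v : V, φ.1 u = φ'.1 v ∧ ψ.1 u = ψ'.1 v := by
    have : (φ.1 u, ψ.1 u) ∈ pairGraph φ'.1 ψ'.1 := h ▸ ⟨u, rfl⟩
    obtain ⟨v, hv⟩ := this
    exact ⟨v, (congrArg Prod.fst hv).symm, (congrArg Prod.snd hv).symm⟩
  have h2 (v : V) : ∃ u : U, ψ.1 u = ψ'.1 v := by
    have : (φ'.1 v, ψ'.1 v) ∈ pairGraph φ.1 ψ.1 := h ▸ ⟨v, rfl⟩
    obtain ⟨u, hu⟩ := this
    exact ⟨u, congrArg Prod.snd hu⟩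
  choose α hα hα' using h1
  let α' : U →* V := MonoidHom.mk' α fun a b => ψ'.injective hΔ <| by
    rw [map_mul, ← hα', ← hα', ← hα', map_mul]
  have hbij : Function.Bijective α' := by
    constructor
    · intro a b hab
      refine ψ.injective hΔ ?_
      rw [hα', hα']
      exact congrArg ψ'.1 hab
    · intro v
      obtain ⟨u, hu⟩ := h2 v
      exact ⟨u, ψ'.injective hΔ ((hα' u).symm.trans hu)⟩
  let e : U ≃* V := MulEquiv.ofBijective α' hbij
  refine ⟨e, mem_homSet_of_comp_eq hS hII hα', ?_, hα, hα'⟩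
  refine mem_homSet_of_comp_eq (φ := ψ') (ψ := ψ) hS hII fun v => ?_
  have h3 := hα' (e.symm v)
  have h4 : α (e.symm v) = v := e.apply_symm_apply v
  rw [h4] at h3
  exact h3.symm

end Pairs

/-! ### The algebra as a product of endomorphism rings -/

section RingIso

variable {G : Type u} [Group G] [Finite G] {R : Type w} [Field R] {S : Set (Subgroup (G × G))}
  {hS : IsStable S}

theorem toLin_sigmaMatrix_tmul (hΔ : ∀ L ∈ S, IsTwistedDiagonal L) (hG : (Nat.card G : R) ≠ 0)
    {U : Subgroup G} (r : R) {X : FinBiset G} (hX : FinBiset.StabilizersIn S X) :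
    Matrix.toLin (permBasis R hS U) (permBasis R hS U)
      (sigmaMatrix R hS U (r ⊗ₜ clsS hS X hX)) = r • sigma R hS U X := by
  refine (permBasis R hS U).ext fun d => ?_
  rw [Matrix.toLin_self, LinearMap.smul_apply, sigma_permBasis, Finset.smul_sum]
  refine Finset.sum_congr rfl fun c _ => ?_
  rw [sigmaMatrix_tmul hΔ hG, mul_smul]

variable (hS) in
/-- The action of `R B^S(G, G)` on the permutation modules. -/
noncomputable def sigmaHom (hΔ : ∀ L ∈ S, IsTwistedDiagonal L) (hG : (Nat.card G : R) ≠ 0)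
    (T : Set (Subgroup G)) :
    BurnsideAlgebra R hS →+* Π U : T, Module.End (OutAlgebra R hS U.1) (PermModule R hS U.1) where
  toFun a U := endOfMatrix (sigmaMatrix R hS U.1 a) (sigmaMatrix_smul a)
  map_zero' := by
    ext U x
    simp [endOfMatrix_apply]
  map_add' a b := by
    ext U x
    simp [endOfMatrix_apply]
  map_one' := by
    ext U x
    rw [endOfMatrix_apply, sigmaMatrix_one hG, Matrix.toLin_one]
    rfl
  map_mul' a b := by
    ext U x
    rw [endOfMatrix_apply, sigmaMatrix_mul hΔ hG,
      Matrix.toLin_mul _ (permBasis R hS U.1)]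
    rfl

theorem sigmaHom_apply (hΔ : ∀ L ∈ S, IsTwistedDiagonal L) (hG : (Nat.card G : R) ≠ 0)
    (T : Set (Subgroup G)) (a : BurnsideAlgebra R hS) (U : T) :
    sigmaHom hS hΔ hG T a U = endOfMatrix (sigmaMatrix R hS U.1 a) (sigmaMatrix_smul a) := rfl

omit [Finite G] in
theorem conjugate_pairGraph_eq {U : Subgroup G} (g h : G) (φ ψ : HomG S U) :
    conjugate (g, h) (pairGraph φ.1 ψ.1) = pairGraph (φ.conj hS g).1 (ψ.conj hS h).1 :=
  (conjugate_pairGraph (fun _ => rfl) fun _ => rfl).symm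

theorem endOfMatrix_injective {U : Subgroup G} {M N : Matrix (HomBar S U) (HomBar S U) R} {hM hN}
    (h : endOfMatrix (hS := hS) M hM = endOfMatrix N hN) : M = N := by
  apply (Matrix.toLin (permBasis R hS U) (permBasis R hS U)).injective
  ext x
  exact DFunLike.congr_fun h x

/-- Up to invertible centralizer orders the matrix entries are marks, and every `L ∈ S` occurs at
some entry for some `U ∈ T`. An element with zero image therefore has all marks zero. -/
theorem sigmaHom_injective (hΔ : ∀ L ∈ S, IsTwistedDiagonal L) (hG : (Nat.card G : R) ≠ 0)
    {T : Set (Subgroup G)} (hT : IsTransversal S T) :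
    Function.Injective (sigmaHom hS hΔ hG T) := by
  rw [injective_iff_map_eq_zero]
  intro a ha
  refine eq_zero_of_ghost_eq_zero hG fun L hL => ?_
  obtain ⟨U, φ, ψ, rfl⟩ := exists_pairGraph_eq hS hΔ hT hL
  have h1 : sigmaMatrix R hS U.1 a = sigmaMatrix R hS U.1 0 :=
    endOfMatrix_injective (hM := sigmaMatrix_smul a) (hN := sigmaMatrix_smul 0)
      ((congrFun ha U).trans (congrFun (map_zero (sigmaHom hS hΔ hG T)) U).symm)
  have h2 := sigmaMatrix_mk a φ ψ
  rw [h1, map_zero, Matrix.zero_apply, eq_comm, mul_eq_zero, inv_eq_zero] at h2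
  exact h2.resolve_left (cardCentralizer_ne_zero _ hG)

theorem IsTransversal.eq_of_isoS {T : Set (Subgroup G)} (hT : IsTransversal S T) (hS : IsStable S)
    {U V : Subgroup G} (hU : U ∈ T) (hV : V ∈ T) (h : IsoS S U V) : U = V :=
  (hT U).unique ⟨hU, MulEquiv.refl U, (autS hS U).one_mem, (autS hS U).one_mem⟩ ⟨hV, h⟩

/-- A family of invariant matrices, with the centralizer normalization removed, defines a function
on pairs of homomorphisms. It descends to a conjugation-invariant function on `S`, which is then
realized by the marks of some element. -/
theorem sigmaHom_surjective (hΔ : ∀ L ∈ S, IsTwistedDiagonal L) (hII : ∀ L ∈ S, opposite L ∈ S)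
    (hG : (Nat.card G : R) ≠ 0) {T : Set (Subgroup G)} (hT : IsTransversal S T) :
    Function.Surjective (sigmaHom hS hΔ hG T) := by
  intro f
  choose M hM hMf using fun U : T => exists_endOfMatrix_eq (f U)
  let val (U : T) (φ ψ : HomG S U.1) : R :=
    (cardCentralizer φ.1 : R) * M U (HomBar.mk φ) (HomBar.mk ψ)
  -- Independence of the parametrization: two of them differ by an isomorphism in the category, the
  -- transversal forces `U = V`, and the matrix is invariant under the resulting element of
  -- `Out(U)`.
  have hval (U V : T) (φ ψ : HomG S U.1) (φ' ψ' : HomG S V.1)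
      (h : pairGraph φ.1 ψ.1 = pairGraph φ'.1 ψ'.1) : val U φ ψ = val V φ' ψ' := by
    obtain ⟨α, hα, hα', h1, h2⟩ := exists_iso_of_pairGraph_eq hS hII hΔ h
    obtain rfl : U = V := Subtype.ext (hT.eq_of_isoS hS U.2 V.2 ⟨α, hα, hα'⟩)
    let α' : autS hS U.1 := ⟨α, hα⟩
    have h3 : φ = φ'.precomp hS α' := Subtype.ext (MonoidHom.ext h1)
    have h4 : ψ = ψ'.precomp hS α' := Subtype.ext (MonoidHom.ext h2)
    have h5 : M U (HomBar.mk φ) (HomBar.mk ψ) = M U (HomBar.mk φ') (HomBar.mk ψ') := by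
      rw [h3, h4]
      exact hM U (MulOpposite.op (QuotientGroup.mk α')) (HomBar.mk φ') (HomBar.mk ψ')
    have h6 : cardCentralizer φ.1 = cardCentralizer φ'.1 := by
      have h7 : φ.1 = φ'.1.comp α.toMonoidHom := MonoidHom.ext h1
      have h8 := pairGraph_comp (α := α.toMonoidHom) φ'.1 φ'.1 α.surjective
      rw [cardCentralizer_eq_fixCount, cardCentralizer_eq_fixCount, h7, h8]
    change _ * _ = _ * _
    rw [h5, h6]
  have hvalc (U : T) (g h : G) (φ ψ : HomG S U.1) :
      val U (φ.conj hS g) (ψ.conj hS h) = val U φ ψ := by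
    have h1 : φ.conj hS g ≈ φ := Setoid.symm ⟨g, fun _ => rfl⟩
    have h2 : ψ.conj hS h ≈ ψ := Setoid.symm ⟨h, fun _ => rfl⟩
    change _ * _ = _ * _
    rw [cardCentralizer_congr h1, HomBar.mk_eq.2 h1, HomBar.mk_eq.2 h2]
  classical
  choose U φ ψ hL using fun L : S => exists_pairGraph_eq hS hΔ hT L.2
  let m (L : Subgroup (G × G)) : R :=
    if h : L ∈ S then val (U ⟨L, h⟩) (φ ⟨L, h⟩) (ψ ⟨L, h⟩) else 0
  have hm (V : T) (φ' ψ' : HomG S V.1) : m (pairGraph φ'.1 ψ'.1) = val V φ' ψ' :=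
    (dif_pos (pairGraph_mem hS hII φ' ψ')).trans (hval _ _ _ _ _ _ (hL ⟨_, _⟩).symm)
  obtain ⟨a, ha⟩ := exists_ghost_eq hS hG m fun L hL g => by
    obtain ⟨V, φ', ψ', rfl⟩ := exists_pairGraph_eq hS hΔ hT hL
    obtain ⟨g, h⟩ := g
    rw [conjugate_pairGraph_eq (hS := hS), hm, hm, hvalc]
  refine ⟨a, funext fun V => ?_⟩
  have h1 : sigmaMatrix R hS V.1 a = M V := by
    ext c d
    rw [sigmaMatrix_apply, ha _ (pairGraph_mem hS hII _ _), hm]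
    change _ * (_ * M V (HomBar.mk _) (HomBar.mk _)) = _
    rw [HomBar.mk_out, HomBar.mk_out, inv_mul_cancel_left₀ (cardCentralizer_ne_zero _ hG)]
  rw [sigmaHom_apply, ← hMf V]
  congr 1

end RingIso

end BurnsideRing

/-! ### Semisimplicity and the classification of simple modules. -/

open BurnsideRing in
theorem corollary5p7 {D : Type v} (Grp : D → Type u) [∀ x, Group (Grp x)] [∀ x, Finite (Grp x)]
    (S : ∀ x y, Set (Subgroup (Grp x × Grp y))) (hI : ConditionI Grp S)
    (hΔ : ∀ x y, ∀ L ∈ S x y, IsTwistedDiagonal L)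
    (G : D) (hII : ∀ L ∈ S G G, opposite L ∈ S G G)
    (T : Set (Subgroup (Grp G))) (hT : IsTransversal (S G G) T)
    (R : Type w) [Field R] (hG : IsUnit (Nat.card (Grp G) : R))
    (hOut : ∀ U ∈ T, IsUnit (Nat.card (OutS (hI.isStable G) U) : R)) :
    IsSemisimpleRing (BurnsideAlgebra R (hI.isStable G)) ∧
    ∃ e : (Σ U : T, OccurringClass R (hI.isStable G) U.1) ≃
        SimpleClass (BurnsideAlgebra R (hI.isStable G)),
      ∀ (U : T) (c : OccurringClass R (hI.isStable G) U.1)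
        (V : SimpleModule (OutAlgebra R (hI.isStable G) U.1))
        (M : SimpleModule (BurnsideAlgebra R (hI.isStable G))),
        SimpleClass.mk V = c.1 → SimpleClass.mk M = e ⟨U, c⟩ →
          Corresponds R (hI.isStable G) U.1 M.1 V.1 := by
  have hS := hI.isStable G
  let σ : BurnsideAlgebra R hS ≃+*
      Π U : T, Module.End (OutAlgebra R hS U.1) (PermModule R hS U.1) :=
    RingEquiv.ofBijective (sigmaHom hS (hΔ G G) hG.ne_zero T)
      ⟨sigmaHom_injective _ _ hT, sigmaHom_surjective _ hII _ hT⟩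
  have h1 (U : T) : IsSemisimpleModule (OutAlgebra R hS U.1) (PermModule R hS U.1) :=
    permModule_isSemisimple (hOut U.1 U.2).ne_zero
  have h2 (U : T) : Module.Finite (OutAlgebra R hS U.1) (PermModule R hS U.1) :=
    permModule_finite
  -- The Burnside algebra lives in `max w (u + 1)` and the modules in `max w u`; the two levels are
  -- given explicitly so that `max a b` matches the first and `b` the second.
  refine ⟨isSemisimpleRing_of_ringEquiv_pi_end.{max w (u + 1), max w u} σ, ?_⟩
  obtain ⟨e, he⟩ := exists_equiv_simpleClass.{max w (u + 1), max w u} σ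
  refine ⟨e, fun U c V M hV hM => ?_⟩
  obtain ⟨f, hf⟩ := he U c V M hV hM
  refine ⟨f, fun r X hX m x => ?_⟩
  rw [hf]
  change Matrix.toLin (permBasis R hS U.1) (permBasis R hS U.1) (sigmaMatrix R hS U.1 _) _ = _
  rw [toLin_sigmaMatrix_tmul (hΔ G G) hG.ne_zero]
  rfl
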